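/- For $p\in\mathbb C$, $|p|<1$, let $(z;p)_\infty=\prod_{j\ge 0}(1-zp^j)$, $\theta(z;p)=(z;p)_\infty(p/z;p)_\infty$ for $z\ne 0$ (so $\theta(z;0)=1-z$, which is used for $z=0$ as well), and, for integers $k\ge 0$, $$(z;q,p)_k=\prod_{j=0}^{k-1}\theta(zq^j;p),\qquad (z_1,\dots,z_m;q,p)_k=(z_1;q,p)_k\cdots(z_m;q,p)_k,\qquad \theta(z)=\theta(z;p).$$ For $k=(k_1,\dots,k_n)\in\mathbb Z_{\ge 0}^n$ write $|k|=k_1+\cdots+k_n$. **Theorem (an $A_n$ elliptic Jackson summation).** Let $n\ge 1$ and $N\ge 0$ be integers, let $p\in\mathbb C$ with $|p|<1$, and let $q,a,c,d,e,b_1,\dots,b_n,x_1,\dots,x_n$ be nonzero complex numbers ($e=0$ is also allowed if $p=0$). Put $B=b_1\cdots b_n$. Assume that no denominator in the identity below vanishes, that is, $\theta(a)\ne0$; $\theta(x_r/x_s)\neq 0$ for $r<s$; $(qx_r/x_s;q,p)_N\ne0$ for all $r,s$; $(ex_r;q,p)_N\ne0$ and $(ex_r/b_r;q,p)_N\neq0$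 for all $r$; and $(aq/B,\,aq/c,\,aq/d,\,aq/Bcd,\,Bcdq^{-N}/a,\,aq^{N+1};q,p)_N\ne 0$. Then $$ \sum_{\substack{k_1,\dots,k_n\ge 0\\ 0\le |k|\le N}}\Bigg( \prod_{1\le r<s\le n}\frac{\theta(q^{k_r-k_s}x_r/x_s)}{\theta(x_r/x_s)} \prod_{r,s=1}^n\frac{(b_sx_r/x_s;q,p)_{k_r}}{(qx_r/x_s;q,p)_{k_r}} \cdot\frac{\theta(aq^{2|k|})}{\theta(a)} $$ $$ \times\frac{(a,\,c,\,d,\,a^2q^{1+N}/Bcd,\,q^{-N};q,p)_{|k|}}{(aq/B,\,aq/c,\,aq/d,\,Bcdq^{-N}/a,\,aq^{N+1};q,p)_{|k|}} \prod_{r=1}^n\frac{(ex_r/B;q,p)_{k_r}\,(ex_r;q,p)_{|k|}}{(ex_r;q,p)_{k_r}\,(ex_r/b_r;q,p)_{|k|}} \cdot q^{\sum_{r=1}^n rk_r}\Bigg) $$ $$ =\frac{(aq,\,aq/Bc,\,aq/Bd,\,aq/cd;q,p)_N}{(aq/B,\,aq/c,\,aq/d,\,aq/Bcd;q,p)_N}.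 $$ -/

import Mathlib

open scoped BigOperators

/-- The infinite shifted factorial `(a; p)_∞ = ∏_{j ≥ 0} (1 - a p^j)`, used for `|p| < 1`. -/
noncomputable def shiftedFacInf (a p : ℂ) : ℂ :=
  ∏' j : ℕ, (1 - a * p ^ j)

/-- For `|p| < 1` the product defining `(a; p)_∞` converges unconditionally. -/
theorem multipliable_shiftedFacInf (a : ℂ) {p : ℂ} (hp : ‖p‖ < 1) :
    Multipliable fun j : ℕ => 1 - a * p ^ j := by
  have h : Summable fun j : ℕ => ‖-(a * p ^ j)‖ := by
    simp only [norm_neg, norm_mul, norm_pow]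
    exact (summable_geometric_of_lt_one (norm_nonneg p) hp).mul_left ‖a‖
  simpa [sub_eq_add_neg] using multipliable_one_add_of_summable h

/-- The modified Jacobi theta function `θ(a; p) = (a; p)_∞ (p/a; p)_∞`, for `a ≠ 0`, `|p| < 1`.
For `p = 0` it is `1 - a`. -/
noncomputable def modTheta (a p : ℂ) : ℂ :=
  shiftedFacInf a p * shiftedFacInf (p / a) p

/-- The theta shifted factorial `(a; q, p)_k = ∏_{j=0}^{k-1} θ(a q^j; p)`, for `k ≥ 0`. -/
noncomputable def thetaFac (a q p : ℂ) (k : ℕ) : ℂ :=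
  ∏ j ∈ Finset.range k, modTheta (a * q ^ j) p

/-- The simplex of all `k = (k_1, …, k_n)` with `k_r ≥ 0` and `|k| = k_1 + ⋯ + k_n ≤ N`. -/
def indexSimplex (n N : ℕ) : Finset (Fin n → ℕ) :=
  (Fintype.piFinset fun _ : Fin n => Finset.range (N + 1)).filter fun k => ∑ r, k r ≤ N

theorem mem_indexSimplex {n N : ℕ} (k : Fin n → ℕ) :
    k ∈ indexSimplex n N ↔ ∑ r, k r ≤ N := by
  simp only [indexSimplex, Finset.mem_filter, Fintype.mem_piFinset, Finset.mem_range,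
    and_iff_right_iff_imp]
  intro h r
  exact Nat.lt_succ_of_le
    ((Finset.single_le_sum (fun i _ => Nat.zero_le (k i)) (Finset.mem_univ r)).trans h)

/-- The elliptic Vandermonde product of type `A`:
`∏_{1 ≤ r < s ≤ n} θ(q^{k_r - k_s} x_r / x_s; p) / θ(x_r / x_s; p)`. -/
noncomputable def ellipticVandermonde {n : ℕ} (x : Fin n → ℂ) (q p : ℂ) (k : Fin n → ℕ) : ℂ :=
  ∏ r : Fin n, ∏ s ∈ Finset.Ioi r,
    modTheta (q ^ ((k r : ℤ) - (k s : ℤ)) * (x r / x s)) p / modTheta (x r / x s) p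

/-!
The summand depends on the multi-index `k` through `|k|` alone, apart from a factor that does not
involve `a`, `c`, `d`. So the sum is evaluated in two stages: the sum over the simplex `|k| = K`,
and then a one-variable sum over `K`.

*The sum over `|k| = K`* (`sum_simplexTerm`). It equals
`(B)_K ∏_r (e x_r / b_r)_K / ((q)_K ∏_r (e x_r)_K)`, and the proof is by induction on `K`. Put
`y_i = x_i q^{k_i}`. By partial fractions, the weights `reachWeight` of the `n` ways to reach `k` by
raising one coordinate add up to a constant. Multiplied by the summand at `k + e_i`, the weight of
the `i`-th way turns into the summand at `k` multiplied by `leaveWeight`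
(`simplexTerm_mul_reachWeight`), and those weights, again by partial fractions, add up to a
constant as well.

*The sum over `K`.* The first stage turns the sum into the one-variable elliptic Jackson summation
with parameters `a, B, c, d` (`sum_jacksonTerm`). That summation is itself the case `n = 2` of the
first stage: on `k_1 + k_2 = N` every factor indexed by `k_2 = N - k_1` is reversed into one indexed
by `k_1`. This argument needs finitely many theta functions of `a` to be nonzero that the final
identity does not divide by. They vanish for countably many `a` only, so continuity in `a` removes
the restriction.

*Partial fractions* (`modTheta_partialFractions`) follow by induction on the number of nodes from
the addition formula, again with a genericity condition removed by continuity.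

*The addition formula* (`modTheta_addition`). The triple product expands `θ(z; p)` as a constant
multiple of a theta series. Splitting the double series for `θ(xy) θ(x/y)` by parity shows that
`K(x, y) = x⁻¹ θ(xy) θ(x/y)` is a sum of two products of a function of `x` and a function of `y`.
As `K` is antisymmetric, the Pfaffian of any four by four matrix of its values vanishes, which is
the addition formula.
-/

open Filter Topology

/-! ### The modified theta function: reflection, continuity, zeros -/


theorem shiftedFacInf_eq_mul (a : ℂ) {p : ℂ} (hp : ‖p‖ < 1) :
    shiftedFacInf a p = (1 - a) * shiftedFacInf (a * p) p := by
  have h := multipliable_shiftedFacInf (a * p) hp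
  have h' : (fun j : ℕ => 1 - a * p * p ^ j) = fun j : ℕ => 1 - a * p ^ (j + 1) := by
    funext j; ring
  unfold shiftedFacInf
  rw [h'] at h ⊢
  simpa using tprod_eq_zero_mul' (f := fun j : ℕ => 1 - a * p ^ j) h

theorem modTheta_eq_mul (z : ℂ) {p : ℂ} (hp : ‖p‖ < 1) :
    modTheta z p = (1 - z) * (shiftedFacInf (z * p) p * shiftedFacInf (p / z) p) := by
  rw [modTheta, shiftedFacInf_eq_mul z hp, mul_assoc]

theorem modTheta_one {p : ℂ} (hp : ‖p‖ < 1) : modTheta 1 p = 0 := by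
  simp [modTheta_eq_mul 1 hp]

theorem modTheta_inv {z p : ℂ} (hp : ‖p‖ < 1) (hz : z ≠ 0) :
    modTheta z⁻¹ p = -z⁻¹ * modTheta z p := by
  rw [modTheta_eq_mul _ hp, modTheta_eq_mul z hp, div_inv_eq_mul, mul_comm p z,
    show z⁻¹ * p = p / z by field_simp]
  field_simp
  ring

theorem modTheta_zero_right (z : ℂ) : modTheta z 0 = 1 - z := by
  rw [modTheta_eq_mul z (by simp)]
  simp [shiftedFacInf]

theorem continuous_shiftedFacInf {p : ℂ} (hp : ‖p‖ < 1) :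
    Continuous fun z => shiftedFacInf z p := by
  rw [continuous_iff_continuousAt]
  intro z₀
  have hu : Summable fun j : ℕ => (‖z₀‖ + 1) * ‖p‖ ^ j :=
    (summable_geometric_of_lt_one (norm_nonneg p) hp).mul_left _
  have h := Summable.hasProdLocallyUniformlyOn_nat_one_add (f := fun (j : ℕ) (z : ℂ) => -(z * p ^ j))
    (K := Metric.ball z₀ 1) Metric.isOpen_ball hu (Eventually.of_forall fun j z hz => by
      rw [norm_neg, norm_mul, norm_pow]
      have : ‖z‖ ≤ ‖z₀‖ + 1 := by
        have h1 := norm_sub_norm_le z z₀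
        rw [Metric.mem_ball, dist_eq_norm] at hz
        linarith
      gcongr) (fun j => by fun_prop)
  have hc := h.continuousOn (Frequently.of_forall fun s => by fun_prop)
  have := hc.continuousAt (Metric.ball_mem_nhds z₀ one_pos)
  simpa [shiftedFacInf, sub_eq_add_neg] using this

theorem continuousAt_modTheta {p z : ℂ} (hp : ‖p‖ < 1) (hz : z ≠ 0 ∨ p = 0) :
    ContinuousAt (fun z => modTheta z p) z := by
  rcases hz with hz | rfl
  · exact ((continuous_shiftedFacInf hp).continuousAt).mul
      ((continuous_shiftedFacInf hp).continuousAt.comp (f := fun z => p / z)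
        (continuousAt_const.div continuousAt_id hz))
  · simp only [modTheta_zero_right]
    fun_prop

theorem exists_of_shiftedFacInf_eq_zero {a p : ℂ} (hp : ‖p‖ < 1) (h : shiftedFacInf a p = 0) :
    ∃ j : ℕ, a * p ^ j = 1 := by
  by_contra! hne
  refine tprod_one_add_ne_zero_of_summable (f := fun j : ℕ => -(a * p ^ j)) (fun j => ?_) ?_ ?_
  · rw [← sub_eq_add_neg, sub_ne_zero]
    exact (hne j).symm
  · simp only [norm_neg, norm_mul, norm_pow]
    exact (summable_geometric_of_lt_one (norm_nonneg p) hp).mul_left ‖a‖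
  · simpa [shiftedFacInf, sub_eq_add_neg] using h

/-- The zeros of the theta function are powers of `p`; in particular they are countably many. -/
theorem exists_zpow_of_modTheta_eq_zero {z p : ℂ} (hp : ‖p‖ < 1) (hz : z ≠ 0)
    (h : modTheta z p = 0) : ∃ m : ℤ, z = p ^ m := by
  rcases mul_eq_zero.mp h with h | h
  · obtain ⟨j, hj⟩ := exists_of_shiftedFacInf_eq_zero hp h
    exact ⟨-j, by rw [zpow_neg, zpow_natCast]; exact eq_inv_of_mul_eq_one_left hj⟩
  · obtain ⟨j, hj⟩ := exists_of_shiftedFacInf_eq_zero hp h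
    refine ⟨(j + 1 : ℕ), ?_⟩
    rw [zpow_natCast]
    field_simp at hj
    rw [← hj]; ring

/-- Functions that are continuous at a point and agree near it off a countable set agree there. -/
theorem eq_of_eventually_eq_off_countable {f g : ℂ → ℂ} {z₀ : ℂ} {S : Set ℂ} (hS : S.Countable)
    (hf : ContinuousAt f z₀) (hg : ContinuousAt g z₀)
    (h : ∀ᶠ z in 𝓝 z₀, z ∉ S → f z = g z) : f z₀ = g z₀ := by
  have hd : Dense Sᶜ := hS.dense_compl ℝ
  have : (𝓝[Sᶜ] z₀).NeBot := mem_closure_iff_nhdsWithin_neBot.mp (hd z₀)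
  have h1 : Tendsto f (𝓝[Sᶜ] z₀) (𝓝 (f z₀)) := hf.mono_left nhdsWithin_le_nhds
  have h2 : Tendsto g (𝓝[Sᶜ] z₀) (𝓝 (g z₀)) := hg.mono_left nhdsWithin_le_nhds
  refine tendsto_nhds_unique_of_eventuallyEq h1 h2 ?_
  rw [EventuallyEq, eventually_nhdsWithin_iff]
  exact h

/-! ### The theta series and the triple product -/

/-- The theta series `∑_{k ∈ ℤ} p^{k(k-1)/2} z^k`, used for `0 < |p| < 1` and `z ≠ 0`. -/
noncomputable def thetaSeries (p z : ℂ) : ℂ :=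
  ∑' k : ℤ, p ^ (k * (k - 1) / 2) * z ^ k

theorem triangle_succ (k : ℤ) : (k + 1) * (k + 1 - 1) / 2 = k * (k - 1) / 2 + k := by
  rw [show (k + 1) * (k + 1 - 1) = k * (k - 1) + k * 2 by ring]
  exact Int.add_mul_ediv_right _ _ (by norm_num)

theorem two_mul_triangle (k : ℤ) : 2 * (k * (k - 1) / 2) = k * (k - 1) :=
  Int.mul_ediv_cancel' (even_iff_two_dvd.mp (by simpa using Int.even_mul_pred_self k))

theorem summable_norm_thetaSeries {p z : ℂ} (hp0 : p ≠ 0) (hp : ‖p‖ < 1) (hz : z ≠ 0) :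
    Summable fun k : ℤ => ‖p ^ (k * (k - 1) / 2) * z ^ k‖ := by
  have key : ∀ w : ℂ, w ≠ 0 → Summable fun n : ℕ =>
      ‖p ^ ((n : ℤ) * ((n : ℤ) - 1) / 2) * w ^ (n : ℤ)‖ := by
    intro w hw
    refine summable_of_ratio_test_tendsto_lt_one (l := 0) one_pos
      (Eventually.of_forall fun n => norm_ne_zero_iff.mpr
        (mul_ne_zero (zpow_ne_zero _ hp0) (zpow_ne_zero _ hw))) ?_
    have h : Tendsto (fun n : ℕ => ‖p‖ ^ n * ‖w‖) atTop (𝓝 (0 * ‖w‖)) :=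
      (tendsto_pow_atTop_nhds_zero_of_lt_one (norm_nonneg p) hp).mul_const _
    rw [zero_mul] at h
    refine h.congr fun n => ?_
    rw [norm_norm, norm_norm, ← norm_div, Nat.cast_succ, triangle_succ, zpow_add₀ hp0,
      zpow_add_one₀ hw, zpow_natCast p n, ← norm_pow, ← norm_mul]
    congr 1
    field_simp
  refine Summable.of_nat_of_neg (key z hz) ?_
  -- `k ↦ -k` replaces `z` by `p / z`
  refine (key (p / z) (div_ne_zero hp0 hz)).congr fun n => ?_
  congr 1
  rw [div_zpow, show (-(n : ℤ)) * (-(n : ℤ) - 1) / 2 = (n : ℤ) * ((n : ℤ) - 1) / 2 + n from by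
    have h1 := two_mul_triangle (n : ℤ)
    have h2 := two_mul_triangle (-(n : ℤ))
    linarith, zpow_add₀ hp0, zpow_neg]
  field_simp

/-- `1 / (p; p)_j` for an integer `j`, with the convention that it vanishes for `j < 0`. -/
noncomputable def invFac (p : ℂ) (j : ℤ) : ℂ :=
  if 0 ≤ j then (∏ i ∈ Finset.range j.toNat, (1 - p ^ (i + 1)))⁻¹ else 0

theorem one_sub_pow_ne_zero {p : ℂ} (hp : ‖p‖ < 1) (i : ℕ) : 1 - p ^ (i + 1) ≠ 0 := by
  rw [sub_ne_zero]
  intro h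
  have : ‖p ^ (i + 1)‖ < 1 := by
    rw [norm_pow]; exact pow_lt_one₀ (norm_nonneg p) hp (by simp)
  rw [← h] at this
  simp at this

/-- With the convention for negative `j`, the recurrence holds for all integers, so that the
Laurent coefficients of the truncated theta function need no boundary cases. -/
theorem invFac_sub_one {p : ℂ} (hp : ‖p‖ < 1) (j : ℤ) :
    invFac p (j - 1) = (1 - p ^ j) * invFac p j := by
  rcases lt_trichotomy j 0 with h | rfl | h
  · rw [invFac, invFac, if_neg (by omega), if_neg (by omega), mul_zero]
  · simp [invFac]
  · obtain ⟨m, rfl⟩ : ∃ m : ℕ, j = (m : ℤ) + 1 := ⟨(j - 1).toNat, by omega⟩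
    have h1 : ((m : ℤ) + 1).toNat = m + 1 := by omega
    have h2 : (p : ℂ) ^ ((m : ℤ) + 1) = p ^ (m + 1) := by
      exact_mod_cast zpow_natCast p (m + 1)
    rw [invFac, invFac, if_pos (by omega), if_pos (by omega), h1, h2, add_sub_cancel_right,
      Int.toNat_natCast, Finset.prod_range_succ, mul_inv]
    field_simp [one_sub_pow_ne_zero hp m]

/-- A finite form of the triple product: the Laurent expansion of the truncated theta function. -/
theorem hasSum_finite_tripleProduct {p z : ℂ} (hp0 : p ≠ 0) (hp : ‖p‖ < 1) (hz : z ≠ 0) (m : ℕ) :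
    HasSum (fun k : ℤ => (∏ i ∈ Finset.range (2 * m), (1 - p ^ (i + 1)))
        * invFac p (m + k) * invFac p (m - k) * (p ^ (k * (k - 1) / 2) * (-z) ^ k))
      (∏ j ∈ Finset.range m, (1 - z * p ^ j) * (1 - p / z * p ^ j)) := by
  have hz' : -z ≠ 0 := neg_ne_zero.mpr hz
  induction m with
  | zero =>
    have : ∀ k : ℤ, k ≠ 0 → (∏ i ∈ Finset.range (2 * 0), (1 - p ^ (i + 1)))
        * invFac p ((0 : ℕ) + k) * invFac p ((0 : ℕ) - k)
        * (p ^ (k * (k - 1) / 2) * (-z) ^ k) = 0 := by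
      intro k hk
      rcases lt_or_gt_of_ne hk with h | h
      · simp [invFac, not_le.mpr h]
      · simp [invFac, not_le.mpr h]
    convert hasSum_single (0 : ℤ) this using 1
    simp [invFac]
  | succ m ih =>
    set P : ℂ := ∏ i ∈ Finset.range (2 * m), (1 - p ^ (i + 1))
    -- multiply the expansion by `(1 - z p ^ m) (1 - p ^ (m + 1) / z)` and shift the indices
    have h0 := ih.mul_left (1 + p ^ (2 * m + 1))
    have h1 := ((Equiv.addRight (-1 : ℤ)).hasSum_iff.mpr ih).mul_left (z * p ^ m)
    have h2 := ((Equiv.addRight (1 : ℤ)).hasSum_iff.mpr ih).mul_left (p / z * p ^ m)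
    have h := (h0.sub h1).sub h2
    rw [Finset.prod_range_succ, show 2 * (m + 1) = 2 * m + 1 + 1 by ring,
      Finset.prod_range_succ, Finset.prod_range_succ]
    have hv : ∀ X : ℂ, X * ((1 - z * p ^ m) * (1 - p / z * p ^ m))
        = (1 + p ^ (2 * m + 1)) * X - z * p ^ m * X - p / z * p ^ m * X := by
      intro X
      rw [show p ^ (2 * m + 1) = p ^ m * p ^ m * p by ring]
      field_simp
      ring
    rw [hv]
    refine Eq.subst (motive := fun f => HasSum f _) (funext fun k => Eq.symm ?_) h
    simp only [Function.comp_apply, Equiv.coe_addRight]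
    have e1 : (k + -1) * (k + -1 - 1) / 2 = k * (k - 1) / 2 - (k - 1) := by
      have := triangle_succ (k - 1)
      rw [sub_add_cancel] at this
      rw [this, ← sub_eq_add_neg]; ring
    rw [e1, triangle_succ, zpow_sub₀ hp0, zpow_add₀ hp0, zpow_add₀ hz', zpow_add₀ hz']
    have r1 := invFac_sub_one hp (m + 1 + k)
    have r2 := invFac_sub_one hp (m + k)
    have r3 := invFac_sub_one hp (m + 1 - k)
    have r4 := invFac_sub_one hp (m - k)
    rw [show (m : ℤ) + 1 + k - 1 = m + k by ring] at r1
    rw [show (m : ℤ) + 1 - k - 1 = m - k by ring] at r3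
    rw [show ((m + 1 : ℕ) : ℤ) + k = m + 1 + k by push_cast; ring,
      show ((m + 1 : ℕ) : ℤ) - k = m + 1 - k by push_cast; ring,
      show (m : ℤ) + (k + -1) = m + k - 1 by ring, show (m : ℤ) - (k + -1) = m + 1 - k by ring,
      show (m : ℤ) + (k + 1) = m + 1 + k by ring, show (m : ℤ) - (k + 1) = m - k - 1 by ring,
      r2, r4, r1, r3]
    have q1 : (p : ℂ) ^ ((m : ℤ) + 1 + k) = p ^ m * p * p ^ k := by
      rw [zpow_add₀ hp0, zpow_add_one₀ hp0, zpow_natCast]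
    have q2 : (p : ℂ) ^ ((m : ℤ) + k) = p ^ m * p ^ k := by
      rw [zpow_add₀ hp0, zpow_natCast]
    have q3 : (p : ℂ) ^ ((m : ℤ) + 1 - k) = p ^ m * p / p ^ k := by
      rw [zpow_sub₀ hp0, zpow_add_one₀ hp0, zpow_natCast]
    have q4 : (p : ℂ) ^ ((m : ℤ) - k) = p ^ m / p ^ k := by
      rw [zpow_sub₀ hp0, zpow_natCast]
    have q5 : (p : ℂ) ^ (k - 1) = p ^ k / p := zpow_sub_one₀ hp0 k
    rw [q1, q2, q3, q4, q5, zpow_one, zpow_neg_one]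
    have hpk : (p : ℂ) ^ k ≠ 0 := zpow_ne_zero k hp0
    generalize invFac p (m + 1 + k) = R
    generalize invFac p (m + 1 - k) = S
    generalize (p : ℂ) ^ (k * (k - 1) / 2) = T
    generalize (-z) ^ k = Z
    generalize (p : ℂ) ^ k = Q at *
    rw [show p ^ (2 * m + 1 + 1) = p ^ m * p ^ m * p * p by ring,
      show p ^ (2 * m + 1) = p ^ m * p ^ m * p by ring]
    generalize (p : ℂ) ^ m = M
    field_simp
    ring

theorem exists_bound_of_tendsto {u : ℕ → ℂ} {l : ℂ} (h : Tendsto u atTop (𝓝 l)) :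
    ∃ M : ℝ, 0 ≤ M ∧ ∀ j, ‖u j‖ ≤ M := by
  obtain ⟨M, hM⟩ := (Metric.isBounded_range_of_tendsto u h).exists_norm_le
  exact ⟨M, (norm_nonneg _).trans (hM (u 0) ⟨0, rfl⟩), fun j => hM _ ⟨j, rfl⟩⟩

/-- The triple product, up to the value of a constant that does not depend on `z`. -/
theorem exists_modTheta_eq_thetaSeries {p : ℂ} (hp0 : p ≠ 0) (hp : ‖p‖ < 1) :
    ∃ C : ℂ, ∀ z : ℂ, z ≠ 0 → modTheta z p = C * thetaSeries p (-z) := by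
  set a : ℕ → ℂ := fun j => ∏ i ∈ Finset.range j, (1 - p ^ (i + 1)) with ha
  have haL : Tendsto a atTop (𝓝 (shiftedFacInf p p)) := by
    have := (multipliable_shiftedFacInf p hp).hasProd.tendsto_prod_nat
    simpa [ha, shiftedFacInf, pow_succ'] using this
  set L := shiftedFacInf p p
  have hL : L ≠ 0 := by
    intro h
    obtain ⟨j, hj⟩ := exists_of_shiftedFacInf_eq_zero hp h
    refine one_sub_pow_ne_zero hp j ?_
    rw [pow_succ', hj, sub_self]
  obtain ⟨M, hM0, hM⟩ := exists_bound_of_tendsto haL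
  obtain ⟨M', hM'0, hM'⟩ := exists_bound_of_tendsto (haL.inv₀ hL)
  have hinv : ∀ j : ℤ, ‖invFac p j‖ ≤ M' := by
    intro j
    unfold invFac
    split_ifs
    · exact hM' _
    · simpa using hM'0
  have htoNat : Tendsto Int.toNat atTop atTop :=
    tendsto_atTop.mpr fun b => (eventually_ge_atTop (b : ℤ)).mono fun j hj => by omega
  have hinvL : Tendsto (invFac p) atTop (𝓝 L⁻¹) := by
    refine ((haL.inv₀ hL).comp htoNat).congr' ?_
    filter_upwards [eventually_ge_atTop (0 : ℤ)] with j hj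
    simp [invFac, hj, ha]
  refine ⟨L * L⁻¹ * L⁻¹, fun z hz => ?_⟩
  have hz' : -z ≠ 0 := neg_ne_zero.mpr hz
  have h1 : Tendsto (fun m : ℕ => ∏ j ∈ Finset.range m, (1 - z * p ^ j) * (1 - p / z * p ^ j)) atTop
      (𝓝 (modTheta z p)) := by
    simp only [Finset.prod_mul_distrib]
    exact (multipliable_shiftedFacInf z hp).hasProd.tendsto_prod_nat.mul
      (multipliable_shiftedFacInf (p / z) hp).hasProd.tendsto_prod_nat
  -- the coefficients of the finite expansions converge and are uniformly dominated
  have h2 := tendsto_tsum_of_dominated_convergence (𝓕 := (atTop : Filter ℕ))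
    (f := fun (m : ℕ) (k : ℤ) => a (2 * m) * invFac p (m + k) * invFac p (m - k)
      * (p ^ (k * (k - 1) / 2) * (-z) ^ k))
    (g := fun k : ℤ => L * L⁻¹ * L⁻¹ * (p ^ (k * (k - 1) / 2) * (-z) ^ k))
    (bound := fun k : ℤ => M * M' * M' * ‖p ^ (k * (k - 1) / 2) * (-z) ^ k‖)
    ((summable_norm_thetaSeries hp0 hp hz').mul_left _)
    (fun k => by
      refine Tendsto.mul_const _ ((Tendsto.mul ?_ ?_).mul ?_)
      · exact haL.comp (tendsto_id.const_mul_atTop' two_pos)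
      · exact hinvL.comp (tendsto_atTop_add_const_right _ k tendsto_natCast_atTop_atTop)
      · exact hinvL.comp (tendsto_atTop_add_const_right _ (-k) tendsto_natCast_atTop_atTop))
    (Eventually.of_forall fun m k => by
      rw [norm_mul, norm_mul, norm_mul]
      gcongr
      · exact hM _
      · exact hinv _
      · exact hinv _)
  rw [thetaSeries, ← tsum_mul_left]
  refine tendsto_nhds_unique h1 (h2.congr fun m => ?_)
  exact (hasSum_finite_tripleProduct hp0 hp hz m).tsum_eq

/-! ### The addition formula -/

/-- Splitting the double series for `S(u) S(v)` by the parity of the sum of the two indices. -/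
theorem thetaSeries_mul {p u v : ℂ} (hp0 : p ≠ 0) (hp : ‖p‖ < 1) (hu : u ≠ 0) (hv : v ≠ 0) :
    thetaSeries p u * thetaSeries p v
      = thetaSeries (p ^ 2) (u * v) * thetaSeries (p ^ 2) (p * (u / v))
        + u * (thetaSeries (p ^ 2) (p * (u * v)) * thetaSeries (p ^ 2) (p ^ 2 * (u / v))) := by
  have hp2 : ‖p ^ 2‖ < 1 := by
    rw [norm_pow]; exact pow_lt_one₀ (norm_nonneg p) hp (by simp)
  have hp20 : p ^ 2 ≠ 0 := pow_ne_zero 2 hp0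
  have huv : u * v ≠ 0 := mul_ne_zero hu hv
  have hudv : u / v ≠ 0 := div_ne_zero hu hv
  have hprod : ∀ {P x y : ℂ}, P ≠ 0 → ‖P‖ < 1 → x ≠ 0 → y ≠ 0 →
      HasSum (fun ij : ℤ × ℤ => (P ^ (ij.1 * (ij.1 - 1) / 2) * x ^ ij.1)
        * (P ^ (ij.2 * (ij.2 - 1) / 2) * y ^ ij.2)) (thetaSeries P x * thetaSeries P y) := by
    intro P x y hP0 hP hx hy
    have sx := summable_norm_thetaSeries hP0 hP hx
    have sy := summable_norm_thetaSeries hP0 hP hy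
    have h := summable_mul_of_summable_norm sx sy
    rw [thetaSeries, thetaSeries, tsum_mul_tsum_of_summable_norm sx sy]
    exact h.hasSum
  have h0 := hprod hp20 hp2 huv (mul_ne_zero hp0 hudv)
  have h1 := (hprod hp20 hp2 (mul_ne_zero hp0 huv) (mul_ne_zero hp20 hudv)).mul_left u
  set F : ℤ × ℤ → ℂ := fun mn => (p ^ (mn.1 * (mn.1 - 1) / 2) * u ^ mn.1)
    * (p ^ (mn.2 * (mn.2 - 1) / 2) * v ^ mn.2) with hF
  -- pairs of even sum are `(i + j, i - j)`, pairs of odd sum are `(i + j + 1, i - j)`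
  set A : ℤ × ℤ → ℤ × ℤ := fun ij => (ij.1 + ij.2, ij.1 - ij.2) with hA
  set B : ℤ × ℤ → ℤ × ℤ := fun ij => (ij.1 + ij.2 + 1, ij.1 - ij.2) with hB
  have hAi : Function.Injective A := by
    rintro ⟨i, j⟩ ⟨i', j'⟩ h
    simp only [hA, Prod.mk.injEq] at h ⊢
    omega
  have hBi : Function.Injective B := by
    rintro ⟨i, j⟩ ⟨i', j'⟩ h
    simp only [hB, Prod.mk.injEq] at h ⊢
    omega
  have hc : IsCompl (Set.range A) (Set.range B) := by
    constructor
    · rw [Set.disjoint_left]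
      rintro _ ⟨⟨i, j⟩, rfl⟩ ⟨⟨i', j'⟩, h⟩
      simp only [hA, hB, Prod.mk.injEq] at h
      omega
    · rw [codisjoint_iff_le_sup]
      rintro ⟨m, n⟩ -
      rcases Int.even_or_odd (m + n) with ⟨i, h⟩ | ⟨i, h⟩
      · exact Or.inl ⟨(i, m - i), by simp only [hA, Prod.mk.injEq]; omega⟩
      · exact Or.inr ⟨(i, m - 1 - i), by simp only [hB, Prod.mk.injEq]; omega⟩
  have e2 : ∀ k : ℤ, (p ^ 2) ^ (k * (k - 1) / 2) = p ^ (k * (k - 1)) := fun k => by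
    conv_rhs => rw [← two_mul_triangle k, zpow_mul]
    norm_cast
  have eA : ∀ ij : ℤ × ℤ, F (A ij) = ((p ^ 2) ^ (ij.1 * (ij.1 - 1) / 2) * (u * v) ^ ij.1)
        * ((p ^ 2) ^ (ij.2 * (ij.2 - 1) / 2) * (p * (u / v)) ^ ij.2) := by
    rintro ⟨i, j⟩
    have e : ((i + j) * (i + j - 1) / 2) + ((i - j) * (i - j - 1) / 2)
        = i * (i - 1) + j * (j - 1) + j := by
      have := two_mul_triangle (i + j)
      have := two_mul_triangle (i - j)
      linarith
    simp only [hF, hA]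
    rw [e2, e2, mul_zpow, mul_zpow, div_zpow, zpow_add₀ hu, zpow_sub₀ hv]
    calc _ = p ^ ((i + j) * (i + j - 1) / 2) * p ^ ((i - j) * (i - j - 1) / 2)
          * (u ^ i * u ^ j * (v ^ i / v ^ j)) := by ring
      _ = _ := by
        rw [← zpow_add₀ hp0, e, zpow_add₀ hp0, zpow_add₀ hp0]; ring
  have eB : ∀ ij : ℤ × ℤ, F (B ij) = u * (((p ^ 2) ^ (ij.1 * (ij.1 - 1) / 2) * (p * (u * v)) ^ ij.1)
        * ((p ^ 2) ^ (ij.2 * (ij.2 - 1) / 2) * (p ^ 2 * (u / v)) ^ ij.2)) := by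
    rintro ⟨i, j⟩
    have e : ((i + j + 1) * (i + j + 1 - 1) / 2) + ((i - j) * (i - j - 1) / 2)
        = i * (i - 1) + i + j * (j - 1) + 2 * j := by
      have := two_mul_triangle (i + j + 1)
      have := two_mul_triangle (i - j)
      linarith
    simp only [hF, hB]
    rw [e2, e2, mul_zpow, mul_zpow, mul_zpow, div_zpow, zpow_add_one₀ hu, zpow_add₀ hu,
      zpow_sub₀ hv, show ((p ^ 2 : ℂ)) ^ j = p ^ (2 * j) by rw [zpow_mul]; norm_cast]
    calc _ = p ^ ((i + j + 1) * (i + j + 1 - 1) / 2) * p ^ ((i - j) * (i - j - 1) / 2)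
          * (u * u ^ i * u ^ j * (v ^ i / v ^ j)) := by ring
      _ = _ := by
        rw [← zpow_add₀ hp0, e, zpow_add₀ hp0, zpow_add₀ hp0, zpow_add₀ hp0]; ring
  have hsum := HasSum.add_isCompl hc (f := F)
    (hAi.hasSum_range_iff.mpr (h0.congr_fun eA)) (hBi.hasSum_range_iff.mpr (h1.congr_fun eB))
  exact (hprod hp0 hp hu hv).unique hsum

/-- An antisymmetric kernel of rank two satisfies the Plücker relation: the square of the
Pfaffian of the four by four matrix of its values is the determinant, which vanishes. -/
theorem plucker_of_rank_two {X : Type*} (K : X → X → ℂ) (f₀ f₁ h₀ h₁ : X → ℂ)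
    (hK : ∀ x y, K x y = f₀ x * h₀ y + f₁ x * h₁ y) (hanti : ∀ x y, K y x = -K x y) (x y u v : X) :
    K x y * K u v - K x u * K y v + K x v * K y u = 0 := by
  have hdiag : ∀ x, K x x = 0 := fun x => by
    have := hanti x x
    linear_combination this / 2
  have hdet : (Matrix.of fun i j => K (![x, y, u, v] i) (![x, y, u, v] j) :
      Matrix (Fin 4) (Fin 4) ℂ).det = 0 := by
    simp only [hK]
    simp [Matrix.det_succ_row_zero, Fin.sum_univ_succ, Fin.succAbove]
    ring
  have hpf : (Matrix.of fun i j => K (![x, y, u, v] i) (![x, y, u, v] j) :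
      Matrix (Fin 4) (Fin 4) ℂ).det = (K x y * K u v - K x u * K y v + K x v * K y u) ^ 2 := by
    simp [Matrix.det_succ_row_zero, Fin.sum_univ_succ, Fin.succAbove, hdiag, hanti x y, hanti x u,
      hanti x v, hanti y u, hanti y v, hanti u v]
    ring
  rw [hpf] at hdet
  exact pow_eq_zero_iff two_ne_zero |>.mp hdet

/-- The addition formula for the modified theta function. -/
theorem modTheta_addition {p : ℂ} (hp : ‖p‖ < 1) {x y u v : ℂ} (hx : x ≠ 0) (hy : y ≠ 0)
    (hu : u ≠ 0) (hv : v ≠ 0) :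
    y * (modTheta (x * y) p * modTheta (x / y) p * modTheta (u * v) p * modTheta (u / v) p)
      - u * (modTheta (x * u) p * modTheta (x / u) p * modTheta (y * v) p * modTheta (y / v) p)
      + u * (modTheta (x * v) p * modTheta (x / v) p * modTheta (y * u) p * modTheta (y / u) p)
      = 0 := by
  rcases eq_or_ne p 0 with rfl | hp0
  · simp only [modTheta_zero_right]
    field_simp
    ring
  obtain ⟨C, hC⟩ := exists_modTheta_eq_thetaSeries hp0 hp
  have h := plucker_of_rank_two (X := {x : ℂ // x ≠ 0})
    (fun x y => (x : ℂ)⁻¹ * (modTheta (x * y) p * modTheta (x / y) p))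
    (fun x => C ^ 2 * (x : ℂ)⁻¹ * thetaSeries (p ^ 2) ((x : ℂ) ^ 2))
    (fun x => -C ^ 2 * thetaSeries (p ^ 2) (p * (x : ℂ) ^ 2))
    (fun y => thetaSeries (p ^ 2) (p * (y : ℂ) ^ 2))
    (fun y => (y : ℂ) * thetaSeries (p ^ 2) (p ^ 2 * (y : ℂ) ^ 2))
    (by
      rintro ⟨x, hx⟩ ⟨y, hy⟩
      have hxy := mul_ne_zero hx hy
      have hxdy := div_ne_zero hx hy
      have := thetaSeries_mul hp0 hp (neg_ne_zero.mpr hxy) (neg_ne_zero.mpr hxdy)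
      rw [show -(x * y) * -(x / y) = x ^ 2 by field_simp,
        show -(x * y) / -(x / y) = y ^ 2 by field_simp] at this
      simp only
      rw [hC _ hxy, hC _ hxdy, mul_mul_mul_comm, this]
      field_simp)
    (by
      rintro ⟨x, hx⟩ ⟨y, hy⟩
      simp only
      rw [show y / x = (x / y)⁻¹ by simp, modTheta_inv hp (div_ne_zero hx hy), mul_comm y x]
      field_simp)
    ⟨x, hx⟩ ⟨y, hy⟩ ⟨u, hu⟩ ⟨v, hv⟩
  simp only at h
  field_simp at h
  linear_combination h

theorem ContinuousAt.modTheta {X : Type*} [TopologicalSpace X] {f : X → ℂ} {x : X} {p : ℂ}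
    (hf : ContinuousAt f x) (hp : ‖p‖ < 1) (h : f x ≠ 0 ∨ p = 0) :
    ContinuousAt (fun x => modTheta (f x) p) x :=
  (continuousAt_modTheta hp h).comp (f := f) hf

/-- The addition formula in interpolation form: as functions of `X`, the products
`θ(X/c) θ(X/d)` with `cd` fixed lie in the span of any two of them. -/
theorem modTheta_three_term {p : ℂ} (hp : ‖p‖ < 1) {A B X c d : ℂ} (hA : A ≠ 0) (hB : B ≠ 0)
    (hX : X ≠ 0) (hc : c ≠ 0) (hd : d ≠ 0) :
    modTheta (A / B) p * modTheta (A * B / (c * d)) p * (modTheta (X / c) p * modTheta (X / d) p)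
      = modTheta (A / c) p * modTheta (A / d) p
          * (modTheta (X / B) p * modTheta (X / (c * d / B)) p)
        - A / B * (modTheta (B / c) p * modTheta (B / d) p)
          * (modTheta (X / A) p * modTheta (X / (c * d / A)) p) := by
  -- scale the variables by a square root of `c * d`
  obtain ⟨s, hs⟩ := IsAlgClosed.exists_pow_nat_eq (c * d) two_pos
  have hs0 : s ≠ 0 := by
    rintro rfl
    exact mul_ne_zero hc hd (by rw [← hs]; simp)
  have h := modTheta_addition hp (div_ne_zero hX hs0) (div_ne_zero hA hs0) (div_ne_zero hB hs0)
    (div_ne_zero hs0 hd)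
  have e1 : ∀ Y : ℂ, Y / s * (s / d) = Y / d := fun Y => by field_simp
  have e2 : ∀ Y : ℂ, Y / s / (s / d) = Y / c := fun Y => by
    field_simp; rw [hs]; ring
  have e3 : ∀ Y Z : ℂ, Y / s / (Z / s) = Y / Z := fun Y Z => by field_simp
  have e4 : ∀ Y Z : ℂ, Y / s * (Z / s) = Y * Z / (c * d) := fun Y Z => by
    rw [← hs]; field_simp
  have e5 : ∀ Y Z : ℂ, Y / (c * d / Z) = Y * Z / (c * d) := fun Y Z => by
    rw [div_div_eq_mul_div]
  simp only [e1, e2, e3, e4] at h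
  rw [e5, e5]
  field_simp at h ⊢
  linear_combination h

/-! ### Partial fractions for theta functions -/

section PartialFractions

variable {ι : Type*} [DecidableEq ι]

/-- A factor `θ(y_i / y_v)` in the summand removes the node `y_v` from an interpolation sum. -/
theorem sum_modTheta_div_mul_erase {p : ℂ} (hp : ‖p‖ < 1) (w : ℂ) (y G : ι → ℂ) {s : Finset ι}
    (hy0 : ∀ i ∈ s, y i ≠ 0) (hy : ∀ i ∈ s, ∀ j ∈ s, i ≠ j → modTheta (y i / y j) p ≠ 0)
    {v : ι} (hv : v ∈ s) :
    ∑ i ∈ s, modTheta (y i / y v) p * G i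
        * ∏ j ∈ s.erase i, modTheta (w * y j) p / modTheta (y i / y j) p
      = modTheta (w * y v) p * ∑ i ∈ s.erase v, G i
        * ∏ j ∈ (s.erase v).erase i, modTheta (w * y j) p / modTheta (y i / y j) p := by
  rw [← Finset.sum_erase s (a := v) (by rw [div_self (hy0 v hv), modTheta_one hp]; ring),
    Finset.mul_sum]
  refine Finset.sum_congr rfl fun i hi => ?_
  obtain ⟨hiv, his⟩ := Finset.mem_erase.mp hi
  rw [← Finset.mul_prod_erase (s.erase i) _ (Finset.mem_erase.mpr ⟨hiv.symm, hv⟩),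
    Finset.erase_right_comm]
  have := hy i his v hv hiv
  field_simp

/-- The inductive step for `modTheta_partialFractions`, under a genericity condition. -/
theorem modTheta_partialFractions_step {p : ℂ} (hp : ‖p‖ < 1) {w : ℂ} (hw : w ≠ 0) (y : ι → ℂ)
    {s : Finset ι} (C : Multiset ℂ) {c d t : ℂ} (hc : c ≠ 0) (hd : d ≠ 0)
    (hy0 : ∀ i ∈ s, y i ≠ 0) (hy : ∀ i ∈ s, ∀ j ∈ s, i ≠ j → modTheta (y i / y j) p ≠ 0)
    {u v : ι} (hu : u ∈ s) (hv : v ∈ s) (huv : u ≠ v)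
    (hg : modTheta (y u * y v / (c * d)) p ≠ 0)
    (ih : ∀ r ∈ s, ∑ i ∈ s.erase r, modTheta (w * y i / t) p
          * (modTheta (y i / (c * d / y r)) p * (C.map fun c => modTheta (y i / c) p).prod)
          * ∏ j ∈ (s.erase r).erase i, modTheta (w * y j) p / modTheta (y i / y j) p
        = modTheta t p * (modTheta (w * (c * d / y r)) p * (C.map fun c => modTheta (w * c) p).prod)) :
    ∑ i ∈ s, modTheta (w * y i / t) p * (modTheta (y i / c) p * (modTheta (y i / d) p
          * (C.map fun c => modTheta (y i / c) p).prod))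
        * ∏ j ∈ s.erase i, modTheta (w * y j) p / modTheta (y i / y j) p
      = modTheta t p * (modTheta (w * c) p * (modTheta (w * d) p
          * (C.map fun c => modTheta (w * c) p).prod)) := by
  have hA := hy0 u hu
  have hB := hy0 v hv
  refine mul_left_cancel₀ (mul_ne_zero (hy u hu v hv huv) hg) ?_
  set G : ι → ι → ℂ := fun r i => modTheta (w * y i / t) p
    * (modTheta (y i / (c * d / y r)) p * (C.map fun c => modTheta (y i / c) p).prod) with hG
  set R : ι → ℂ := fun i => ∏ j ∈ s.erase i, modTheta (w * y j) p / modTheta (y i / y j) p with hR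
  have key : ∀ r ∈ s, ∑ i ∈ s, modTheta (y i / y r) p * G r i * R i
      = modTheta t p * (modTheta (w * y r) p * modTheta (w * (c * d / y r)) p
        * (C.map fun c => modTheta (w * c) p).prod) := by
    intro r hr
    rw [sum_modTheta_div_mul_erase hp w y (G r) hy0 hy hr, ih r hr]
    ring
  -- the same relation at `X = 1 / w`
  have hwT : modTheta (y u / y v) p * modTheta (y u * y v / (c * d)) p
        * (modTheta (w * c) p * modTheta (w * d) p)
      = modTheta (y u / c) p * modTheta (y u / d) p
          * (modTheta (w * y v) p * modTheta (w * (c * d / y v)) p)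
        - y u / y v * (modTheta (y v / c) p * modTheta (y v / d) p)
          * (modTheta (w * y u) p * modTheta (w * (c * d / y u)) p) := by
    have h := modTheta_three_term hp hA hB (inv_ne_zero hw) hc hd
    have e : ∀ z : ℂ, z ≠ 0 → modTheta (w⁻¹ / z) p = -(w * z)⁻¹ * modTheta (w * z) p := by
      intro z hz
      rw [← modTheta_inv hp (mul_ne_zero hw hz)]
      congr 1
      field_simp
    rw [e c hc, e d hd, e _ hA, e _ hB, e _ (div_ne_zero (mul_ne_zero hc hd) hA), e _ (div_ne_zero (mul_ne_zero hc hd) hB)] at h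
    field_simp at h ⊢
    linear_combination h
  calc _ = ∑ i ∈ s, (modTheta (y u / c) p * modTheta (y u / d) p
            * (modTheta (y i / y v) p * G v i * R i)
          - y u / y v * (modTheta (y v / c) p * modTheta (y v / d) p)
            * (modTheta (y i / y u) p * G u i * R i)) := by
        rw [Finset.mul_sum]
        refine Finset.sum_congr rfl fun i hi => ?_
        have h := modTheta_three_term hp hA hB (hy0 i hi) hc hd
        simp only [hG, hR]
        linear_combination (modTheta (w * y i / t) p * (C.map fun c => modTheta (y i / c) p).prod
          * ∏ j ∈ s.erase i, modTheta (w * y j) p / modTheta (y i / y j) p) * h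
    _ = _ := by
        rw [Finset.sum_sub_distrib, ← Finset.mul_sum, ← Finset.mul_sum, key v hv, key u hu]
        linear_combination (-modTheta t p * (C.map fun c => modTheta (w * c) p).prod) * hwT

/-- Induction on the number of nodes. The inductive step needs `θ(y_u y_v / (c d)) ≠ 0`, which holds
for all but countably many `c`; the identity is continuous in `c`. -/
theorem modTheta_partialFractions_of_ne_zero {p : ℂ} (hp : ‖p‖ < 1) {w : ℂ} (hw : w ≠ 0)
    (y : ι → ℂ) {s : Finset ι} (hs : s.Nonempty) (C : Multiset ℂ) (hC : C.card = s.card)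
    (hC0 : ∀ c ∈ C, c ≠ 0) (hy0 : ∀ i ∈ s, y i ≠ 0)
    (hy : ∀ i ∈ s, ∀ j ∈ s, i ≠ j → modTheta (y i / y j) p ≠ 0) {t : ℂ}
    (ht : t = (∏ i ∈ s, y i) / C.prod) :
    ∑ i ∈ s, modTheta (w * y i / t) p * (C.map fun c => modTheta (y i / c) p).prod
        * ∏ j ∈ s.erase i, modTheta (w * y j) p / modTheta (y i / y j) p
      = modTheta t p * (C.map fun c => modTheta (w * c) p).prod := by
  obtain ⟨m, hm⟩ : ∃ m, s.card = m + 1 := ⟨s.card - 1, by have := hs.card_pos; omega⟩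
  induction m generalizing s C t with
  | zero =>
    obtain ⟨i, rfl⟩ := Finset.card_eq_one.mp hm
    rw [hm] at hC
    obtain ⟨c, rfl⟩ := Multiset.card_eq_one.mp hC
    have hc : c ≠ 0 := hC0 c (by simp)
    have hi : y i ≠ 0 := hy0 i (by simp)
    subst ht
    simp only [Finset.sum_singleton, Multiset.map_singleton, Multiset.prod_singleton,
      Finset.erase_singleton, Finset.prod_empty, Finset.prod_singleton]
    rw [show w * y i / (y i / c) = w * c by field_simp]
    ring
  | succ m ih =>
    obtain ⟨c, C₁, rfl⟩ : ∃ c C₁, C = c ::ₘ C₁ :=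
      Multiset.exists_cons_of_mem (Multiset.card_pos_iff_exists_mem.mp (by omega)).choose_spec
        |>.elim fun C₁ h => ⟨_, C₁, h⟩
    rw [Multiset.card_cons, hm] at hC
    obtain ⟨d, C', rfl⟩ : ∃ d C', C₁ = d ::ₘ C' :=
      Multiset.exists_cons_of_mem (Multiset.card_pos_iff_exists_mem.mp (by omega)).choose_spec
        |>.elim fun C₁ h => ⟨_, C₁, h⟩
    rw [Multiset.card_cons] at hC
    obtain ⟨u, hu, v, hv, huv⟩ := Finset.one_lt_card.mp (show 1 < s.card by omega)
    have hc : c ≠ 0 := hC0 c (by simp)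
    have hd : d ≠ 0 := hC0 d (by simp)
    have hC' : ∀ x ∈ C', x ≠ 0 := fun x hx => hC0 x (by simp [hx])
    have hP : C'.prod ≠ 0 := Multiset.prod_ne_zero fun h => hC' 0 h rfl
    have hY : ∏ i ∈ s, y i ≠ 0 := Finset.prod_ne_zero_iff.mpr hy0
    have hA := hy0 u hu
    have hB := hy0 v hv
    -- the identity with `c` replaced by a generic `c'`
    have generic : ∀ c' : ℂ, c' ≠ 0 → modTheta (y u * y v / (c' * d)) p ≠ 0 →
        ∑ i ∈ s, modTheta (w * y i / ((∏ i ∈ s, y i) / (c' * (d * C'.prod)))) p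
            * (modTheta (y i / c') p * (modTheta (y i / d) p
              * (C'.map fun c => modTheta (y i / c) p).prod))
            * ∏ j ∈ s.erase i, modTheta (w * y j) p / modTheta (y i / y j) p
          = modTheta ((∏ i ∈ s, y i) / (c' * (d * C'.prod))) p
            * (modTheta (w * c') p * (modTheta (w * d) p
              * (C'.map fun c => modTheta (w * c) p).prod)) := by
      intro c' hc' hg
      refine modTheta_partialFractions_step hp hw y C' hc' hd hy0 hy hu hv huv hg fun r hr => ?_
      have hcard : (s.erase r).card = m + 1 := by rw [Finset.card_erase_of_mem hr]; omega
      have hr0 := hy0 r hr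
      have h := ih (s := s.erase r) (Finset.card_pos.mp (by omega)) (c' * d / y r ::ₘ C')
        (t := (∏ i ∈ s, y i) / (c' * (d * C'.prod)))
        (by rw [Multiset.card_cons]; omega)
        (by
          intro x hx
          rcases Multiset.mem_cons.mp hx with rfl | hx
          · exact div_ne_zero (mul_ne_zero hc' hd) hr0
          · exact hC' x hx)
        (fun i hi => hy0 i (Finset.mem_of_mem_erase hi))
        (fun i hi j hj => hy i (Finset.mem_of_mem_erase hi) j (Finset.mem_of_mem_erase hj))
        (by rw [← Finset.mul_prod_erase s y hr, Multiset.prod_cons]; field_simp)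
        hcard
      simpa only [Multiset.map_cons, Multiset.prod_cons] using h
    subst ht
    simp only [Multiset.map_cons, Multiset.prod_cons]
    have hne : ∀ z : ℂ, z ≠ 0 → (∏ i ∈ s, y i) / (z * (d * C'.prod)) ≠ 0 := fun z hz =>
      div_ne_zero hY (mul_ne_zero hz (mul_ne_zero hd hP))
    have hcont : ContinuousAt (fun z : ℂ => (∏ i ∈ s, y i) / (z * (d * C'.prod))) c :=
      continuousAt_const.div (by fun_prop) (mul_ne_zero hc (mul_ne_zero hd hP))
    -- the exceptional values of `c'` form a countable set
    refine eq_of_eventually_eq_off_countable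
      (f := fun z => ∑ i ∈ s, modTheta (w * y i / ((∏ i ∈ s, y i) / (z * (d * C'.prod)))) p
            * (modTheta (y i / z) p * (modTheta (y i / d) p
              * (C'.map fun c => modTheta (y i / c) p).prod))
            * ∏ j ∈ s.erase i, modTheta (w * y j) p / modTheta (y i / y j) p)
      (g := fun z => modTheta ((∏ i ∈ s, y i) / (z * (d * C'.prod))) p
            * (modTheta (w * z) p * (modTheta (w * d) p
              * (C'.map fun c => modTheta (w * c) p).prod)))
      (Set.countable_range fun k : ℤ => y u * y v / (d * p ^ k)) ?_ ?_ ?_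
    · refine tendsto_finsetSum _ fun i hi => ?_
      refine ContinuousAt.mul (ContinuousAt.mul ?_ (ContinuousAt.mul ?_ continuousAt_const))
        continuousAt_const
      · exact (continuousAt_const.div hcont (hne c hc)).modTheta hp
          (Or.inl (div_ne_zero (mul_ne_zero hw (hy0 i hi)) (hne c hc)))
      · exact (continuousAt_const.div continuousAt_id hc).modTheta hp
          (Or.inl (div_ne_zero (hy0 i hi) hc))
    · refine ContinuousAt.mul (hcont.modTheta hp (Or.inl (hne c hc)))
        (ContinuousAt.mul ?_ continuousAt_const)
      exact (continuousAt_const.mul continuousAt_id).modTheta hp (Or.inl (mul_ne_zero hw hc))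
    · filter_upwards [isOpen_ne.mem_nhds hc] with z hz hzS
      refine generic z hz fun h0 => hzS ?_
      obtain ⟨k, hk⟩ := exists_zpow_of_modTheta_eq_zero hp
        (div_ne_zero (mul_ne_zero hA hB) (mul_ne_zero hz hd)) h0
      refine ⟨k, ?_⟩
      simp only
      rw [← hk]
      field_simp

/-- Partial fractions for theta functions, as an interpolation formula for the theta function
`w ↦ ∏_c θ(w c)` with nodes `1 / y_i`. The formula is free of divisions by `θ(w y_i)`. The value
`w = 0` makes sense only for `p = 0`. -/
theorem modTheta_partialFractions {p : ℂ} (hp : ‖p‖ < 1) {w : ℂ} (hw : w ≠ 0 ∨ p = 0)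
    (y : ι → ℂ) {s : Finset ι} (hs : s.Nonempty) (C : Multiset ℂ) (hC : C.card = s.card)
    (hC0 : ∀ c ∈ C, c ≠ 0) (hy0 : ∀ i ∈ s, y i ≠ 0)
    (hy : ∀ i ∈ s, ∀ j ∈ s, i ≠ j → modTheta (y i / y j) p ≠ 0) {t : ℂ}
    (ht : t = (∏ i ∈ s, y i) / C.prod) :
    ∑ i ∈ s, modTheta (w * y i / t) p * (C.map fun c => modTheta (y i / c) p).prod
        * ∏ j ∈ s.erase i, modTheta (w * y j) p / modTheta (y i / y j) p
      = modTheta t p * (C.map fun c => modTheta (w * c) p).prod := by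
  rcases eq_or_ne w 0 with rfl | hw0
  -- for `p = 0` both sides are continuous at `w = 0`
  · have hp0 : p = 0 := by tauto
    subst hp0
    refine eq_of_eventually_eq_off_countable
      (f := fun w => ∑ i ∈ s, modTheta (w * y i / t) 0 * (C.map fun c => modTheta (y i / c) 0).prod
        * ∏ j ∈ s.erase i, modTheta (w * y j) 0 / modTheta (y i / y j) 0)
      (g := fun w => modTheta t 0 * (C.map fun c => modTheta (w * c) 0).prod)
      (Set.countable_singleton 0) ?_ ?_ (Eventually.of_forall fun w hw =>
        modTheta_partialFractions_of_ne_zero hp hw y hs C hC hC0 hy0 hy ht)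
    · simp only [modTheta_zero_right, div_eq_mul_inv]
      fun_prop
    · simp only [modTheta_zero_right]
      refine (continuous_const.mul (continuous_multiset_prod C fun c _ => ?_)).continuousAt
      fun_prop
  · exact modTheta_partialFractions_of_ne_zero hp hw0 y hs C hC hC0 hy0 hy ht

end PartialFractions

/-! ### Theta shifted factorials -/

theorem modTheta_inv_ne_zero {z p : ℂ} (hp : ‖p‖ < 1) (hz : z ≠ 0) (h : modTheta z p ≠ 0) :
    modTheta z⁻¹ p ≠ 0 := by
  rw [modTheta_inv hp hz]
  exact mul_ne_zero (neg_ne_zero.mpr (inv_ne_zero hz)) h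

theorem thetaFac_zero (a q p : ℂ) : thetaFac a q p 0 = 1 := by simp [thetaFac]

theorem thetaFac_succ (a q p : ℂ) (k : ℕ) :
    thetaFac a q p (k + 1) = thetaFac a q p k * modTheta (a * q ^ k) p :=
  Finset.prod_range_succ _ _

theorem modTheta_ne_zero_of_thetaFac {a q p : ℂ} {N j : ℕ} (h : thetaFac a q p N ≠ 0)
    (hj : j < N) : modTheta (a * q ^ j) p ≠ 0 :=
  Finset.prod_ne_zero_iff.mp h j (Finset.mem_range.mpr hj)

theorem thetaFac_ne_zero_of_le {a q p : ℂ} {N k : ℕ} (h : thetaFac a q p N ≠ 0) (hk : k ≤ N) :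
    thetaFac a q p k ≠ 0 :=
  Finset.prod_ne_zero_iff.mpr fun _ hj =>
    modTheta_ne_zero_of_thetaFac h ((Finset.mem_range.mp hj).trans_le hk)

/-! ### The `A_n` summation over a simplex `|k| = N` -/

section An

variable {n : ℕ} {q p : ℂ} {x : Fin n → ℂ}

/-- The nodes `x_r q^{k_r}` are distinct modulo powers of `p`. -/
theorem modTheta_shifted_div_ne_zero (hp : ‖p‖ < 1) (hq : q ≠ 0) (hx : ∀ r, x r ≠ 0) {N : ℕ}
    (hvand : ∀ r s, r < s → modTheta (x r / x s) p ≠ 0)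
    (hqx : ∀ r s, thetaFac (q * (x r / x s)) q p N ≠ 0) {r s : Fin n} (hrs : r ≠ s)
    {k l : ℕ} (hk : k ≤ N) (hl : l ≤ N) :
    modTheta (x r * q ^ k / (x s * q ^ l)) p ≠ 0 := by
  have key : ∀ (r s : Fin n) (j : ℕ), j < N → modTheta (x r / x s * q ^ (j + 1)) p ≠ 0 := by
    intro r s j hj
    have := modTheta_ne_zero_of_thetaFac (hqx r s) hj
    rwa [show q * (x r / x s) * q ^ j = x r / x s * q ^ (j + 1) by ring] at this
  have hrx := hx r
  have hsx := hx s
  rcases lt_trichotomy k l with h | rfl | h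
  · obtain ⟨j, rfl⟩ := Nat.exists_eq_add_of_lt h
    have := modTheta_inv_ne_zero hp (by positivity) (key s r j (by omega))
    convert this using 2
    field_simp
    ring
  · rw [mul_div_mul_right _ _ (pow_ne_zero k hq)]
    rcases lt_or_gt_of_ne hrs with h | h
    · exact hvand r s h
    · have := modTheta_inv_ne_zero hp (by positivity) (hvand s r h)
      rwa [inv_div] at this
  · obtain ⟨j, rfl⟩ := Nat.exists_eq_add_of_lt h
    convert key r s j (by omega) using 2
    field_simp
    ring

theorem prod_add_single {M : Type*} [CommMonoid M] (f : Fin n → ℕ → M) (k : Fin n → ℕ) (i : Fin n)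
    {ρ : M} (h : f i (k i + 1) = f i (k i) * ρ) :
    ∏ r, f r ((k + Pi.single i 1 : Fin n → ℕ) r) = (∏ r, f r (k r)) * ρ := by
  rw [← Finset.mul_prod_erase _ _ (Finset.mem_univ i),
    ← Finset.mul_prod_erase _ (fun r => f r (k r)) (Finset.mem_univ i), Pi.add_apply,
    Pi.single_eq_same, h, mul_right_comm]
  congr 2
  refine Finset.prod_congr rfl fun r hr => ?_
  rw [Pi.add_apply, Pi.single_eq_of_ne (Finset.ne_of_mem_erase hr), add_zero]

/-- The factor by which a product over pairs `r < s` changes when only the pairs containing `i`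
change, in the shape needed for the elliptic Vandermonde product. -/
theorem prod_pairs_eq (i : Fin n) (c : ℂ) (f g : Fin n → Fin n → ℂ) (ψ : Fin n → ℂ)
    (h : ∀ r s, r < s → r ≠ i → s ≠ i → g r s = f r s)
    (h₁ : ∀ s, i < s → g i s = f i s * ψ s) (h₂ : ∀ r, r < i → g r i = f r i * (c * ψ r)) :
    ∏ r, ∏ s ∈ Finset.Ioi r, g r s
      = (∏ r, ∏ s ∈ Finset.Ioi r, f r s) * (c ^ (i : ℕ) * ∏ j ∈ Finset.univ.erase i, ψ j) := by
  have hg : ∀ r : Fin n, ∏ s ∈ Finset.Ioi r, g r s = (∏ s ∈ Finset.Ioi r, f r s)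
      * (if r = i then ∏ s ∈ Finset.Ioi i, ψ s else if r < i then c * ψ r else 1) := by
    intro r
    rcases eq_or_ne r i with rfl | hri
    · rw [if_pos rfl, ← Finset.prod_mul_distrib]
      exact Finset.prod_congr rfl fun s hs => h₁ s (Finset.mem_Ioi.mp hs)
    rw [if_neg hri]
    split_ifs with hlt
    · have hi : i ∈ Finset.Ioi r := Finset.mem_Ioi.mpr hlt
      rw [← Finset.mul_prod_erase _ _ hi, ← Finset.mul_prod_erase _ (f r) hi, h₂ r hlt,
        mul_right_comm]
      congr 2
      refine Finset.prod_congr rfl fun s hs => ?_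
      rw [Finset.mem_erase, Finset.mem_Ioi] at hs
      exact h r s hs.2 hri hs.1
    · rw [mul_one]
      refine Finset.prod_congr rfl fun s hs => ?_
      rw [Finset.mem_Ioi] at hs
      exact h r s hs hri fun e => hlt (e ▸ hs)
  rw [Finset.prod_congr rfl fun r _ => hg r, Finset.prod_mul_distrib]
  congr 1
  have hsplit : Finset.univ.erase i = Finset.Iio i ∪ Finset.Ioi i := by
    ext j
    simp [lt_or_lt_iff_ne]
  have hdisj : Disjoint (Finset.Iio i) (Finset.Ioi i) := by
    rw [Finset.disjoint_left]
    intro j hj hj'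
    exact lt_asymm (Finset.mem_Iio.mp hj) (Finset.mem_Ioi.mp hj')
  rw [← Finset.mul_prod_erase _ _ (Finset.mem_univ i), if_pos rfl, hsplit,
    Finset.prod_union hdisj, Finset.prod_union hdisj]
  have e1 : ∏ r ∈ Finset.Iio i, (if r = i then ∏ s ∈ Finset.Ioi i, ψ s
      else if r < i then c * ψ r else 1) = c ^ (i : ℕ) * ∏ r ∈ Finset.Iio i, ψ r := by
    rw [Finset.prod_congr rfl fun r hr => by
      rw [if_neg (Finset.mem_Iio.mp hr).ne, if_pos (Finset.mem_Iio.mp hr)],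
      Finset.prod_mul_distrib, Finset.prod_const, Fin.card_Iio]
  have e2 : ∏ r ∈ Finset.Ioi i, (if r = i then ∏ s ∈ Finset.Ioi i, ψ s
      else if r < i then c * ψ r else 1) = 1 :=
    Finset.prod_eq_one fun r hr => by
      rw [if_neg (Finset.mem_Ioi.mp hr).ne', if_neg (Finset.mem_Ioi.mp hr).not_gt]
  rw [e1, e2]
  ring

theorem ellipticVandermonde_eq (hq : q ≠ 0) (hx : ∀ r, x r ≠ 0) (k : Fin n → ℕ) :
    ellipticVandermonde x q p k = ∏ r : Fin n, ∏ s ∈ Finset.Ioi r,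
      modTheta (x r * q ^ k r / (x s * q ^ k s)) p / modTheta (x r / x s) p := by
  refine Finset.prod_congr rfl fun r _ => Finset.prod_congr rfl fun s _ => ?_
  have := hx s
  rw [zpow_sub₀ hq, zpow_natCast, zpow_natCast]
  congr 2
  field_simp

/-- The change of the elliptic Vandermonde product when `k_i` is raised by one. The factor `q ^ i`,
where `i` is the number of `r < i`, comes from the reflection `θ(1/z) = -θ(z)/z`. -/
theorem ellipticVandermonde_add_single (hp : ‖p‖ < 1) (hq : q ≠ 0) (hx : ∀ r, x r ≠ 0)
    (k : Fin n → ℕ) (i : Fin n)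
    (hne : ∀ r s, r ≠ s → modTheta (x r * q ^ k r / (x s * q ^ k s)) p ≠ 0) :
    ellipticVandermonde x q p (k + Pi.single i 1) * q ^ (i : ℕ)
      = ellipticVandermonde x q p k * ∏ j ∈ Finset.univ.erase i,
        (modTheta (q * (x i * q ^ k i) / (x j * q ^ k j)) p
          / modTheta (x i * q ^ k i / (x j * q ^ k j)) p) := by
  rw [ellipticVandermonde_eq hq hx, ellipticVandermonde_eq hq hx,
    prod_pairs_eq i q⁻¹
    (ψ := fun j => modTheta (q * (x i * q ^ k i) / (x j * q ^ k j)) p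
      / modTheta (x i * q ^ k i / (x j * q ^ k j)) p)
    (f := fun r s => modTheta (x r * q ^ k r / (x s * q ^ k s)) p / modTheta (x r / x s) p)]
  · rw [inv_pow]
    have := pow_ne_zero (i : ℕ) hq
    field_simp
  · intro r s _ hr hs
    simp [Pi.single_eq_of_ne hr, Pi.single_eq_of_ne hs]
  · intro s his
    have h := hne i s his.ne
    simp only [Pi.add_apply, Pi.single_eq_same, Pi.single_eq_of_ne his.ne', add_zero]
    rw [show x i * q ^ (k i + 1) = q * (x i * q ^ k i) by ring]
    field_simp
  · intro r hri
    have h := hne i r hri.ne'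
    have hyi : x i * q ^ k i ≠ 0 := mul_ne_zero (hx i) (pow_ne_zero _ hq)
    have hyr : x r * q ^ k r ≠ 0 := mul_ne_zero (hx r) (pow_ne_zero _ hq)
    simp only [Pi.add_apply, Pi.single_eq_same, Pi.single_eq_of_ne hri.ne, add_zero]
    rw [show x i * q ^ (k i + 1) = q * (x i * q ^ k i) by ring]
    generalize x i * q ^ k i = Y at *
    generalize x r * q ^ k r = Z at *
    rw [show Z / (q * Y) = (q * Y / Z)⁻¹ by rw [inv_div], show Z / Y = (Y / Z)⁻¹ by rw [inv_div],
      modTheta_inv hp (div_ne_zero (mul_ne_zero hq hyi) hyr), modTheta_inv hp (div_ne_zero hyi hyr)]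
    field_simp

/-- The summand of the `A_n` summation over the simplex `|k| = N`; it does not depend on `N`. -/
noncomputable def simplexTerm (x b : Fin n → ℂ) (e B q p : ℂ) (k : Fin n → ℕ) : ℂ :=
  ellipticVandermonde x q p k
    * (∏ r, ∏ s, thetaFac (b s * (x r / x s)) q p (k r) / thetaFac (q * (x r / x s)) q p (k r))
    * (∏ r, thetaFac (e * x r / B) q p (k r) / thetaFac (e * x r) q p (k r))
    * q ^ (∑ r : Fin n, (r : ℕ) * k r)

/-- The weight of the `i`-th way to reach the index `k`; for `|k| = N + 1` these weights add up to
a constant, by partial fractions. -/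
noncomputable def reachWeight (x : Fin n → ℂ) (e q p : ℂ) (N : ℕ) (k : Fin n → ℕ) (i : Fin n) : ℂ :=
  modTheta (e * q ^ N * (x i * q ^ k i) / q ^ (N + 1)) p * (∏ j, modTheta (x i * q ^ k i / x j) p)
    * ∏ j ∈ Finset.univ.erase i,
      modTheta (e * q ^ N * (x j * q ^ k j)) p / modTheta (x i * q ^ k i / (x j * q ^ k j)) p

/-- The weight of the `i`-th way to leave the index `k`; for `|k| = N` these weights add up to a
constant, by partial fractions. -/
noncomputable def leaveWeight (x b : Fin n → ℂ) (e B q p : ℂ) (N : ℕ) (k : Fin n → ℕ) (i : Fin n) :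
    ℂ :=
  modTheta (e * q ^ N * (x i * q ^ k i) / (q ^ N * B)) p
    * (∏ j, modTheta (x i * q ^ k i / (x j / b j)) p)
    * ∏ j ∈ Finset.univ.erase i,
      modTheta (e * q ^ N * (x j * q ^ k j)) p / modTheta (x i * q ^ k i / (x j * q ^ k j)) p

/-- Reaching `k + e_i` by its `i`-th way is the same as leaving `k` by its `i`-th way. -/
theorem simplexTerm_mul_reachWeight (hp : ‖p‖ < 1) (hq : q ≠ 0) (hx : ∀ r, x r ≠ 0)
    (b : Fin n → ℂ) (e B : ℂ) {N : ℕ}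
    (hvand : ∀ r s, r < s → modTheta (x r / x s) p ≠ 0)
    (hqx : ∀ r s, thetaFac (q * (x r / x s)) q p (N + 1) ≠ 0)
    (hex : ∀ r, thetaFac (e * x r) q p (N + 1) ≠ 0) {k : Fin n → ℕ} (hk : ∀ r, k r ≤ N)
    (i : Fin n) :
    simplexTerm x b e B q p (k + Pi.single i 1) * reachWeight x e q p N (k + Pi.single i 1) i
      = simplexTerm x b e B q p k * leaveWeight x b e B q p N k i := by
  have hne : ∀ r s, r ≠ s → modTheta (x r * q ^ k r / (x s * q ^ k s)) p ≠ 0 := fun r s hrs =>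
    modTheta_shifted_div_ne_zero hp hq hx hvand hqx hrs ((hk r).trans (Nat.le_succ N))
      ((hk s).trans (Nat.le_succ N))
  have hne' : ∀ s, i ≠ s → modTheta (q * (x i * q ^ k i) / (x s * q ^ k s)) p ≠ 0 := fun s his => by
    have := modTheta_shifted_div_ne_zero hp hq hx hvand hqx his (Nat.succ_le_succ (hk i))
      ((hk s).trans (Nat.le_succ N))
    rwa [show x i * q ^ (k i + 1) = q * (x i * q ^ k i) by ring] at this
  have hqN : q ^ N ≠ 0 := pow_ne_zero N hq
  have hV := ellipticVandermonde_add_single hp hq hx k i hne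
  have h1 := prod_add_single (fun r m => ∏ s, thetaFac (b s * (x r / x s)) q p m
      / thetaFac (q * (x r / x s)) q p m) k i
    (ρ := ∏ s, modTheta (x i * q ^ k i / (x s / b s)) p / modTheta (q * (x i * q ^ k i) / x s) p)
    (by
      rw [← Finset.prod_mul_distrib]
      refine Finset.prod_congr rfl fun s _ => ?_
      rw [thetaFac_succ, thetaFac_succ, mul_div_mul_comm]
      congr 3
      · rw [div_div_eq_mul_div]; ring
      · ring)
  have h2 := prod_add_single (fun r m => thetaFac (e * x r / B) q p m / thetaFac (e * x r) q p m) k i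
    (ρ := modTheta (e * q ^ N * (x i * q ^ k i) / (q ^ N * B)) p / modTheta (e * (x i * q ^ k i)) p)
    (by
      rw [thetaFac_succ, thetaFac_succ, mul_div_mul_comm]
      congr 3
      · rw [mul_comm (q ^ N) B, mul_right_comm e, mul_div_mul_right _ _ hqN]; ring
      · ring)
  have h3 : q ^ (∑ r : Fin n, (r : ℕ) * (k + Pi.single i 1 : Fin n → ℕ) r)
      = q ^ (∑ r : Fin n, (r : ℕ) * k r) * q ^ (i : ℕ) := by
    rw [← pow_add]
    congr 1
    simp [mul_add, Finset.sum_add_distrib, Pi.single_apply]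
  have h4 : reachWeight x e q p N (k + Pi.single i 1) i
      = modTheta (e * (x i * q ^ k i)) p * (∏ j, modTheta (q * (x i * q ^ k i) / x j) p)
        * ∏ j ∈ Finset.univ.erase i, modTheta (e * q ^ N * (x j * q ^ k j)) p
          / modTheta (q * (x i * q ^ k i) / (x j * q ^ k j)) p := by
    rw [reachWeight, Pi.add_apply, Pi.single_eq_same,
      show x i * q ^ (k i + 1) = q * (x i * q ^ k i) by ring]
    congr 1
    · congr 2
      rw [pow_succ]
      field_simp
    · refine Finset.prod_congr rfl fun j hj => ?_
      rw [Pi.add_apply, Pi.single_eq_of_ne (Finset.ne_of_mem_erase hj), add_zero]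
  have h5 : modTheta (e * (x i * q ^ k i)) p ≠ 0 := by
    have := modTheta_ne_zero_of_thetaFac (hex i) (Nat.lt_succ_of_le (hk i))
    rwa [mul_assoc] at this
  have h6 : ∏ j, modTheta (q * (x i * q ^ k i) / x j) p ≠ 0 :=
    Finset.prod_ne_zero_iff.mpr fun j _ => by
      have := modTheta_ne_zero_of_thetaFac (hqx i j) (Nat.lt_succ_of_le (hk i))
      rwa [show q * (x i / x j) * q ^ k i = q * (x i * q ^ k i) / x j by ring] at this
  have h7 : ∏ j ∈ Finset.univ.erase i, modTheta (q * (x i * q ^ k i) / (x j * q ^ k j)) p ≠ 0 :=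
    Finset.prod_ne_zero_iff.mpr fun j hj => hne' j (Finset.ne_of_mem_erase hj).symm
  have h8 : ∏ j ∈ Finset.univ.erase i, modTheta (x i * q ^ k i / (x j * q ^ k j)) p ≠ 0 :=
    Finset.prod_ne_zero_iff.mpr fun j hj => hne i j (Finset.ne_of_mem_erase hj).symm
  unfold simplexTerm
  rw [h1, h2, h3, h4, leaveWeight]
  simp only [Finset.prod_div_distrib (s := Finset.univ.erase i)] at hV ⊢
  rw [Finset.prod_div_distrib (f := fun s => modTheta (x i * q ^ k i / (x s / b s)) p)]
  generalize (∏ r, ∏ s, thetaFac (b s * (x r / x s)) q p (k r)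
    / thetaFac (q * (x r / x s)) q p (k r)) = a1
  generalize (∏ r, thetaFac (e * x r / B) q p (k r) / thetaFac (e * x r) q p (k r)) = a2
  generalize ellipticVandermonde x q p (k + Pi.single i 1) = v1 at *
  generalize ellipticVandermonde x q p k = v0 at *
  generalize ∏ j ∈ Finset.univ.erase i, modTheta (q * (x i * q ^ k i) / (x j * q ^ k j)) p = a3 at *
  generalize ∏ j ∈ Finset.univ.erase i, modTheta (x i * q ^ k i / (x j * q ^ k j)) p = a4 at *
  generalize ∏ j ∈ Finset.univ.erase i, modTheta (e * q ^ N * (x j * q ^ k j)) p = a5 at *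
  generalize ∏ j, modTheta (q * (x i * q ^ k i) / x j) p = a6 at *
  generalize ∏ j, modTheta (x i * q ^ k i / (x j / b j)) p = a7 at *
  generalize modTheta (e * (x i * q ^ k i)) p = a8 at *
  generalize modTheta (e * q ^ N * (x i * q ^ k i) / (q ^ N * B)) p = a9 at *
  generalize q ^ (∑ r : Fin n, (r : ℕ) * k r) = Q
  field_simp at hV ⊢
  linear_combination (a1 * a7 * a2 * a9 * Q * a5) * hV

theorem sum_piAntidiag_succ (N : ℕ) (i : Fin n) (f : (Fin n → ℕ) → ℂ)
    (hf : ∀ k, k i = 0 → f k = 0) :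
    ∑ k ∈ Finset.piAntidiag Finset.univ (N + 1), f k
      = ∑ k ∈ Finset.piAntidiag Finset.univ N, f (k + Pi.single i 1) := by
  symm
  refine Finset.sum_of_injOn (fun k => k + Pi.single i 1) (fun k _ l _ h => add_right_cancel h)
    ?_ ?_ (fun _ _ => rfl)
  · intro k hk
    simp only [Finset.mem_coe, Finset.mem_piAntidiag] at hk ⊢
    simp [Finset.sum_add_distrib, hk.1]
  · intro k hk hk'
    refine hf k ?_
    by_contra h0
    refine hk' ⟨k - Pi.single i 1, ?_, ?_⟩
    · have hle : ∀ r, (Pi.single i 1 : Fin n → ℕ) r ≤ k r := fun r => by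
        rcases eq_or_ne r i with rfl | hr
        · simpa using Nat.one_le_iff_ne_zero.mpr h0
        · simp [Pi.single_eq_of_ne hr]
      have hs : ∑ r, k r = N + 1 := (Finset.mem_piAntidiag.mp hk).1
      have : ∑ r, (k - Pi.single i 1 : Fin n → ℕ) r + ∑ r, (Pi.single i 1 : Fin n → ℕ) r = ∑ r, k r := by
        rw [← Finset.sum_add_distrib]
        exact Finset.sum_congr rfl fun r _ => Nat.sub_add_cancel (hle r)
      simp only [Finset.mem_coe, Finset.mem_piAntidiag, Finset.mem_univ, implies_true, and_true]
      simp at this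
      simp only [Pi.sub_apply]
      omega
    · funext r
      rcases eq_or_ne r i with rfl | hr
      · simpa using Nat.sub_add_cancel (Nat.one_le_iff_ne_zero.mpr h0)
      · simp [Pi.single_eq_of_ne hr]

/-- The `A_n` summation over the simplex `|k| = N`. -/
theorem sum_simplexTerm (hn : 0 < n) (hp : ‖p‖ < 1) (hq : q ≠ 0) (hx : ∀ r, x r ≠ 0)
    {b : Fin n → ℂ} (hb : ∀ r, b r ≠ 0) {e B : ℂ} (hB : B = ∏ s, b s) (he : e ≠ 0 ∨ p = 0) (N : ℕ)
    (hvand : ∀ r s, r < s → modTheta (x r / x s) p ≠ 0)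
    (hqx : ∀ r s, thetaFac (q * (x r / x s)) q p N ≠ 0)
    (hex : ∀ r, thetaFac (e * x r) q p N ≠ 0) :
    (∑ k ∈ Finset.piAntidiag Finset.univ N, simplexTerm x b e B q p k)
        * (thetaFac q q p N * ∏ r, thetaFac (e * x r) q p N)
      = thetaFac B q p N * ∏ r, thetaFac (e * x r / b r) q p N := by
  have : Nonempty (Fin n) := ⟨⟨0, hn⟩⟩
  induction N with
  | zero =>
    have hV : ellipticVandermonde x q p 0 = 1 := by
      refine Finset.prod_eq_one fun r _ => Finset.prod_eq_one fun s hs => ?_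
      simpa using div_self (hvand r s (Finset.mem_Ioi.mp hs))
    simp [simplexTerm, thetaFac_zero, hV]
  | succ N ih =>
    specialize ih (fun r s => thetaFac_ne_zero_of_le (hqx r s) (Nat.le_succ N))
      (fun r => thetaFac_ne_zero_of_le (hex r) (Nat.le_succ N))
    have hB0 : B ≠ 0 := hB ▸ Finset.prod_ne_zero_iff.mpr fun s _ => hb s
    have hX : ∏ r, x r ≠ 0 := Finset.prod_ne_zero_iff.mpr fun s _ => hx s
    have hw : e * q ^ N ≠ 0 ∨ p = 0 := he.imp_left fun h => mul_ne_zero h (pow_ne_zero N hq)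
    have hle : ∀ {M : ℕ} {k : Fin n → ℕ}, k ∈ Finset.piAntidiag Finset.univ M → ∀ r, k r ≤ M := by
      intro M k hk r
      rw [← (Finset.mem_piAntidiag.mp hk).1]
      exact Finset.single_le_sum (fun i _ => Nat.zero_le (k i)) (Finset.mem_univ r)
    have hprodq : ∀ {M : ℕ} {k : Fin n → ℕ}, k ∈ Finset.piAntidiag Finset.univ M →
        ∏ r, x r * q ^ k r = (∏ r, x r) * q ^ M := by
      intro M k hk
      rw [Finset.prod_mul_distrib, Finset.prod_pow_eq_pow_sum, (Finset.mem_piAntidiag.mp hk).1]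
    have hy0 : ∀ (k : Fin n → ℕ), ∀ i ∈ Finset.univ, x i * q ^ k i ≠ 0 := fun k i _ =>
      mul_ne_zero (hx i) (pow_ne_zero _ hq)
    -- partial fractions for `∏ θ(w x_r)` and for `∏ θ(w x_r / b_r)`, both at `w = e q ^ N`
    have hreach : ∀ k ∈ Finset.piAntidiag Finset.univ (N + 1), ∑ i, reachWeight x e q p N k i
        = modTheta (q ^ (N + 1)) p * ∏ r, modTheta (e * q ^ N * x r) p := by
      intro k hk
      have h := modTheta_partialFractions hp hw (fun i => x i * q ^ k i)
        (s := Finset.univ) Finset.univ_nonempty (Finset.univ.val.map x) (by simp)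
        (by simpa using hx) (hy0 k)
        (fun i _ j _ hij => modTheta_shifted_div_ne_zero hp hq hx hvand hqx hij (hle hk i) (hle hk j))
        (t := q ^ (N + 1)) (by
          rw [hprodq hk]
          exact (mul_div_cancel_left₀ _ hX).symm)
      simp only [Multiset.map_map] at h
      exact h
    have hleave : ∀ k ∈ Finset.piAntidiag Finset.univ N, ∑ i, leaveWeight x b e B q p N k i
        = modTheta (q ^ N * B) p * ∏ r, modTheta (e * q ^ N * (x r / b r)) p := by
      intro k hk
      have h := modTheta_partialFractions hp hw (fun i => x i * q ^ k i)
        (s := Finset.univ) Finset.univ_nonempty (Finset.univ.val.map fun r => x r / b r) (by simp)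
        (by simpa using fun r => ⟨hx r, hb r⟩) (hy0 k)
        (fun i _ j _ hij => modTheta_shifted_div_ne_zero hp hq hx hvand hqx hij
          ((hle hk i).trans (Nat.le_succ N)) ((hle hk j).trans (Nat.le_succ N)))
        (t := q ^ N * B) (by
          rw [hprodq hk]
          change _ = _ / ∏ r, x r / b r
          rw [Finset.prod_div_distrib, ← hB]
          field_simp)
      simp only [Multiset.map_map] at h
      exact h
    -- an index with `k_i = 0` cannot be reached by raising the `i`-th coordinate
    have hzero : ∀ (k : Fin n → ℕ) (i : Fin n), k i = 0 → reachWeight x e q p N k i = 0 := by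
      intro k i hki
      have : ∏ j, modTheta (x i * q ^ k i / x j) p = 0 :=
        Finset.prod_eq_zero (Finset.mem_univ i) (by
          rw [hki, pow_zero, mul_one, div_self (hx i), modTheta_one hp])
      rw [reachWeight, this]
      ring
    have key : (∑ k ∈ Finset.piAntidiag Finset.univ (N + 1), simplexTerm x b e B q p k)
          * (modTheta (q ^ (N + 1)) p * ∏ r, modTheta (e * q ^ N * x r) p)
        = (∑ k ∈ Finset.piAntidiag Finset.univ N, simplexTerm x b e B q p k)
          * (modTheta (q ^ N * B) p * ∏ r, modTheta (e * q ^ N * (x r / b r)) p) := by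
      calc _ = ∑ k ∈ Finset.piAntidiag Finset.univ (N + 1), ∑ i,
              simplexTerm x b e B q p k * reachWeight x e q p N k i := by
            rw [Finset.sum_mul]
            refine Finset.sum_congr rfl fun k hk => ?_
            rw [← hreach k hk, Finset.mul_sum]
        _ = ∑ i, ∑ k ∈ Finset.piAntidiag Finset.univ N,
              simplexTerm x b e B q p (k + Pi.single i 1)
                * reachWeight x e q p N (k + Pi.single i 1) i := by
            rw [Finset.sum_comm]
            refine Finset.sum_congr rfl fun i _ => ?_
            exact sum_piAntidiag_succ N i
              (fun k => simplexTerm x b e B q p k * reachWeight x e q p N k i)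
              (fun k hk => by simp only [hzero k i hk, mul_zero])
        _ = ∑ k ∈ Finset.piAntidiag Finset.univ N, ∑ i,
              simplexTerm x b e B q p k * leaveWeight x b e B q p N k i := by
            rw [Finset.sum_comm]
            refine Finset.sum_congr rfl fun k hk => Finset.sum_congr rfl fun i _ => ?_
            exact simplexTerm_mul_reachWeight hp hq hx b e B hvand hqx hex (hle hk) i
        _ = _ := by
            rw [Finset.sum_mul]
            refine Finset.sum_congr rfl fun k hk => ?_
            rw [← hleave k hk, Finset.mul_sum]
    have e1 : ∀ r, e * x r * q ^ N = e * q ^ N * x r := fun r => by ring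
    have e2 : ∀ r, e * x r / b r * q ^ N = e * q ^ N * (x r / b r) := fun r => by ring
    simp only [thetaFac_succ, Finset.prod_mul_distrib, e1, e2]
    rw [show q * q ^ N = q ^ (N + 1) by ring, mul_comm B (q ^ N)]
    linear_combination (thetaFac q q p N * ∏ r, thetaFac (e * x r) q p N) * key
      + (modTheta (q ^ N * B) p * ∏ r, modTheta (e * q ^ N * (x r / b r)) p) * ih

end An

/-! ### The one-variable elliptic Jackson summation -/

theorem thetaFac_succ' (a q p : ℂ) (k : ℕ) :
    thetaFac a q p (k + 1) = modTheta a p * thetaFac (a * q) q p k := by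
  simp only [thetaFac, Finset.prod_range_succ', pow_zero, mul_one]
  rw [mul_comm]
  congr 1
  exact Finset.prod_congr rfl fun j _ => by ring_nf

/-- Reversal of a theta shifted factorial; here `v = q^{1 - N} / u`. -/
theorem thetaFac_sub_mul {u v q p : ℂ} (hp : ‖p‖ < 1) (hu : u ≠ 0) (hq : q ≠ 0) {N : ℕ}
    (huv : v * u * q ^ N = q) {k : ℕ} (hk : k ≤ N) :
    thetaFac u q p (N - k) * ((-u) ^ k * (∏ i ∈ Finset.range k, q ^ (N - 1 - i)) * thetaFac v q p k)
      = thetaFac u q p N := by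
  induction k with
  | zero => simp [thetaFac_zero]
  | succ k ih =>
    obtain ⟨m, rfl⟩ := Nat.exists_eq_add_of_le hk
    rw [← ih (by omega), show k + 1 + m - k = m + 1 by omega, show k + 1 + m - (k + 1) = m by omega,
      thetaFac_succ, thetaFac_succ, Finset.prod_range_succ, show k + 1 + m - 1 - k = m by omega]
    have hum : u * q ^ m ≠ 0 := mul_ne_zero hu (pow_ne_zero m hq)
    have h : v * q ^ k = (u * q ^ m)⁻¹ := by
      refine eq_inv_of_mul_eq_one_left (mul_right_cancel₀ hq ?_)
      linear_combination huv
    rw [h, modTheta_inv hp hum]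
    field_simp
    ring

theorem thetaFac_reverse {u v q p : ℂ} (hp : ‖p‖ < 1) (hu : u ≠ 0) (hq : q ≠ 0) {N : ℕ}
    (huv : v * u * q ^ N = q) :
    thetaFac u q p N
      = (-u) ^ N * (∏ i ∈ Finset.range N, q ^ (N - 1 - i)) * thetaFac v q p N := by
  rw [← thetaFac_sub_mul hp hu hq huv le_rfl, Nat.sub_self, thetaFac_zero, one_mul]

theorem thetaFac_ne_zero_of_reverse {u v q p : ℂ} (hp : ‖p‖ < 1) (hu : u ≠ 0) (hq : q ≠ 0) {N : ℕ}
    (huv : v * u * q ^ N = q) (hv : thetaFac v q p N ≠ 0) : thetaFac u q p N ≠ 0 := by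
  rw [thetaFac_reverse hp hu hq huv]
  exact mul_ne_zero (mul_ne_zero (pow_ne_zero _ (neg_ne_zero.mpr hu))
    (Finset.prod_ne_zero_iff.mpr fun _ _ => pow_ne_zero _ hq)) hv

/-- The summand of the one-variable elliptic Jackson (Frenkel–Turaev) summation. -/
noncomputable def jacksonTerm (a b c d q p : ℂ) (N k : ℕ) : ℂ :=
  modTheta (a * q ^ (2 * k)) p / modTheta a p
    * ((thetaFac a q p k * thetaFac b q p k * thetaFac c q p k * thetaFac d q p k
          * thetaFac (a ^ 2 * q ^ (1 + N) / (b * c * d)) q p k * thetaFac (q ^ (-(N : ℤ))) q p k)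
        / (thetaFac q q p k * thetaFac (a * q / b) q p k * thetaFac (a * q / c) q p k
          * thetaFac (a * q / d) q p k * thetaFac (b * c * d * q ^ (-(N : ℤ)) / a) q p k
          * thetaFac (a * q ^ (N + 1)) q p k))
    * q ^ k

section Jackson

variable {a b c d q p : ℂ} {N : ℕ}

/-- In dimension two and for suitable parameters, the summand over the simplex `k₁ + k₂ = N` is
proportional to the summand of the one-variable elliptic Jackson summation. -/
theorem simplexTerm_two (hp : ‖p‖ < 1) (hq : q ≠ 0) (ha : a ≠ 0) (hb : b ≠ 0) (hc : c ≠ 0)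
    (hd : d ≠ 0) {Q : ℂ} (hQ : Q = q ^ (-(N : ℤ))) {k : ℕ} (hk : k ≤ N)
    (hθ : modTheta a p ≠ 0) (hθN : modTheta (a * q ^ N) p ≠ 0)
    (hqN : thetaFac q q p N ≠ 0) (haQ : thetaFac (q * Q / a) q p N ≠ 0)
    (hbN : thetaFac (a * q / b) q p N ≠ 0) (hcN : thetaFac (a * q / c) q p N ≠ 0)
    (hdN : thetaFac (a * q / d) q p N ≠ 0)
    (heN : thetaFac (b * c * d * Q / a) q p N ≠ 0)
    (heQ : thetaFac (b * c * d * Q / a * (Q / a)) q p N ≠ 0)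
    (haN : thetaFac (a * q ^ (N + 1)) q p N ≠ 0) :
    simplexTerm ![1, Q / a] ![b, c * (Q / a)] (b * c * d * Q / a) (b * (c * (Q / a))) q p ![k, N - k]
        * (thetaFac (q * Q / a) q p N * thetaFac q q p N
          * thetaFac (b * c * d * Q / a * (Q / a)) q p N) * modTheta (a * q ^ N) p
      = jacksonTerm a b c d q p N k * (q ^ N * modTheta a p * (thetaFac (b * Q / a) q p N
          * thetaFac (c * Q / a) q p N * thetaFac (d * Q / a) q p N)) := by
  have hQ0 : Q ≠ 0 := hQ ▸ zpow_ne_zero _ hq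
  have hQq : Q * q ^ N = 1 := by rw [hQ, zpow_neg, zpow_natCast, inv_mul_cancel₀ (pow_ne_zero N hq)]
  have hqN0 : q ^ N ≠ 0 := pow_ne_zero N hq
  have hV : ellipticVandermonde ![1, Q / a] q p ![k, N - k]
      = modTheta (a * q ^ (2 * k)) p / modTheta (a * q ^ N) p := by
    have h1 : Finset.Ioi (0 : Fin 2) = {1} := by decide
    have h2 : Finset.Ioi (1 : Fin 2) = ∅ := by decide
    have h3 : (1 : ℂ) / (Q / a) = a * q ^ N := by
      rw [one_div_div, div_eq_iff hQ0]
      linear_combination -a * hQq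
    simp only [ellipticVandermonde, Fin.prod_univ_two, h1, h2, Finset.prod_singleton,
      Finset.prod_empty, mul_one, Matrix.cons_val_zero, Matrix.cons_val_one, h3]
    congr 2
    rw [Nat.cast_sub hk, show (k : ℤ) - ((N : ℤ) - k) = (2 * k : ℕ) - (N : ℤ) by push_cast; ring,
      zpow_sub₀ hq, zpow_natCast, zpow_natCast]
    field_simp
  have r1 := thetaFac_sub_mul (u := b * Q / a) (v := a * q / b) hp (by positivity) hq (N := N)
    (by field_simp; linear_combination hQq) hk
  have r2 := thetaFac_sub_mul (u := c * Q / a) (v := a * q / c) hp (by positivity) hq (N := N)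
    (by field_simp; linear_combination hQq) hk
  have r3 := thetaFac_sub_mul (u := d * Q / a) (v := a * q / d) hp (by positivity) hq (N := N)
    (by field_simp; linear_combination hQq) hk
  have r4 := thetaFac_sub_mul (u := q * Q / a) (v := a) hp (by positivity) hq (N := N)
    (by field_simp; linear_combination hQq) hk
  have r5 := thetaFac_sub_mul (u := q) (v := Q) hp hq hq (N := N) (by linear_combination q * hQq) hk
  have r6 := thetaFac_sub_mul (u := b * c * d * Q / a * (Q / a))
    (v := a ^ 2 * q ^ (1 + N) / (b * c * d)) hp (by positivity) hq (N := N)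
    (by rw [pow_add]; field_simp; linear_combination (Q * q ^ N + 1) * hQq) hk
  have hQa : Q / a ≠ 0 := div_ne_zero hQ0 ha
  have a1 : b * ((1 : ℂ) / 1) = b := by ring
  have a2 : c * (Q / a) * (1 / (Q / a)) = c := by field_simp
  have a3 : q * ((1 : ℂ) / 1) = q := by ring
  have a4 : q * (1 / (Q / a)) = a * q ^ (N + 1) := by
    rw [one_div_div, pow_succ]
    field_simp
    linear_combination -hQq
  have a5 : b * (Q / a / 1) = b * Q / a := by ring
  have a6 : c * (Q / a) * (Q / a / (Q / a)) = c * Q / a := by field_simp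
  have a7 : q * (Q / a / 1) = q * Q / a := by ring
  have a8 : q * (Q / a / (Q / a)) = q := by field_simp
  have a9 : b * c * d * Q / a / (b * (c * (Q / a))) = d := by field_simp
  have a10 : b * c * d * Q / a * (Q / a) / (b * (c * (Q / a))) = d * Q / a := by field_simp
  simp only [simplexTerm, hV, Fin.prod_univ_two, Fin.sum_univ_two, Matrix.cons_val_zero,
    Matrix.cons_val_one, a1, a2, a3, a4, a5, a6, a7, a8, a9, a10, mul_one, Fin.val_zero,
    Fin.val_one, zero_mul, one_mul, zero_add]
  have n1 := thetaFac_ne_zero_of_le hqN hk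
  have n2 := thetaFac_ne_zero_of_le haN hk
  have n3 := thetaFac_ne_zero_of_le heN hk
  have n4 := thetaFac_ne_zero_of_le haQ (Nat.sub_le N k)
  have n5 := thetaFac_ne_zero_of_le hqN (Nat.sub_le N k)
  have n6 := thetaFac_ne_zero_of_le heQ (Nat.sub_le N k)
  have n7 := thetaFac_ne_zero_of_le hbN hk
  have n8 := thetaFac_ne_zero_of_le hcN hk
  have n9 := thetaFac_ne_zero_of_le hdN hk
  have hM : ∏ i ∈ Finset.range k, q ^ (N - 1 - i) ≠ 0 :=
    Finset.prod_ne_zero_iff.mpr fun _ _ => pow_ne_zero _ hq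
  -- the powers produced by the six reversals combine to `q ^ (2 * k)`
  have hpow : q ^ (N - k) * ((-(q * Q / a)) ^ k * (-q) ^ k * (-(b * c * d * Q / a * (Q / a))) ^ k)
      = q ^ N * q ^ k * ((-(b * Q / a)) ^ k * (-(c * Q / a)) ^ k * (-(d * Q / a)) ^ k) := by
    have e : q ^ N = q ^ (N - k) * q ^ k := by rw [← pow_add, Nat.sub_add_cancel hk]
    rw [e, ← mul_pow, ← mul_pow, ← mul_pow, ← mul_pow, mul_assoc (q ^ (N - k)),
      mul_assoc (q ^ (N - k)), ← mul_pow, ← mul_pow]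
    congr 2
    ring
  rw [← r1, ← r2, ← r3, ← r4, ← r5, ← r6, jacksonTerm, ← hQ]
  generalize (-(q * Q / a)) ^ k = P4 at *
  generalize (-q) ^ k = P5 at *
  generalize (-(b * c * d * Q / a * (Q / a))) ^ k = P6 at *
  generalize (-(b * Q / a)) ^ k = P1 at *
  generalize (-(c * Q / a)) ^ k = P2 at *
  generalize (-(d * Q / a)) ^ k = P3 at *
  generalize ∏ i ∈ Finset.range k, q ^ (N - 1 - i) = M at *
  generalize thetaFac (b * c * d * Q / a * (Q / a)) q p (N - k) = X6 at *
  generalize thetaFac (q * Q / a) q p (N - k) = X4 at *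
  generalize thetaFac q q p (N - k) = X5 at *
  generalize thetaFac (a * q / b) q p k = Y1 at *
  generalize thetaFac (a * q / c) q p k = Y2 at *
  generalize thetaFac (a * q / d) q p k = Y3 at *
  generalize thetaFac (b * c * d * Q / a) q p k = Y4 at *
  generalize thetaFac (a * q ^ (N + 1)) q p k = Y5 at *
  generalize thetaFac q q p k = Y6 at *
  generalize thetaFac (a ^ 2 * q ^ (1 + N) / (b * c * d)) q p k = Z1
  generalize thetaFac a q p k = Z2
  generalize thetaFac Q q p k = Z3
  generalize thetaFac b q p k = Z4
  generalize thetaFac c q p k = Z5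
  generalize thetaFac d q p k = Z6
  generalize thetaFac (b * Q / a) q p (N - k) = X1
  generalize thetaFac (c * Q / a) q p (N - k) = X2
  generalize thetaFac (d * Q / a) q p (N - k) = X3
  generalize modTheta (a * q ^ (2 * k)) p = T2
  generalize modTheta (a * q ^ N) p = TN at *
  generalize modTheta a p = T at *
  generalize q ^ (N - k) = q1 at *
  generalize q ^ N = q2 at *
  generalize q ^ k = q3 at *
  clear r1 r2 r3 r4 r5 r6 a1 a2 a3 a4 a5 a6 a7 a8 a9 a10 hQq
  field_simp
  linear_combination (T2 * Z1 * Z2 * Z3 * Z4 * Z5 * Z6 * X1 * X2 * X3) * hpow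

/-- The elliptic Jackson summation, for parameters avoiding a few exceptional hypersurfaces. -/
theorem sum_jacksonTerm_of_generic (hp : ‖p‖ < 1) (hq : q ≠ 0) (ha : a ≠ 0) (hb : b ≠ 0)
    (hc : c ≠ 0) (hd : d ≠ 0) (hqN : thetaFac q q p N ≠ 0)
    (hbN : thetaFac (a * q / b) q p N ≠ 0) (hcN : thetaFac (a * q / c) q p N ≠ 0)
    (hdN : thetaFac (a * q / d) q p N ≠ 0)
    (heN : thetaFac (b * c * d * q ^ (-(N : ℤ)) / a) q p N ≠ 0)
    (hbcd : thetaFac (a * q / (b * c * d)) q p N ≠ 0)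
    (haj : ∀ j ≤ 2 * N, modTheta (a * q ^ j) p ≠ 0)
    (he' : thetaFac (a ^ 2 * q ^ (1 + N) / (b * c * d)) q p N ≠ 0) :
    ∑ k ∈ Finset.range (N + 1), jacksonTerm a b c d q p N k
      = (thetaFac (a * q) q p N * thetaFac (a * q / (b * c)) q p N
          * thetaFac (a * q / (b * d)) q p N * thetaFac (a * q / (c * d)) q p N)
        / (thetaFac (a * q / b) q p N * thetaFac (a * q / c) q p N
          * thetaFac (a * q / d) q p N * thetaFac (a * q / (b * c * d)) q p N) := by
  obtain ⟨Q, hQ⟩ : ∃ Q, Q = q ^ (-(N : ℤ)) := ⟨_, rfl⟩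
  have hQ0 : Q ≠ 0 := hQ ▸ zpow_ne_zero _ hq
  have hQq : Q * q ^ N = 1 := by rw [hQ, zpow_neg, zpow_natCast, inv_mul_cancel₀ (pow_ne_zero N hq)]
  have hqN0 : q ^ N ≠ 0 := pow_ne_zero N hq
  have hQa : Q / a ≠ 0 := div_ne_zero hQ0 ha
  rw [← hQ] at heN
  have hθ : modTheta a p ≠ 0 := by simpa using haj 0 (by omega)
  have hθN : modTheta (a * q ^ N) p ≠ 0 := haj N (by omega)
  have haN : thetaFac (a * q ^ (N + 1)) q p N ≠ 0 := Finset.prod_ne_zero_iff.mpr fun j hj => by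
    have hj := Finset.mem_range.mp hj
    rw [mul_assoc, ← pow_add]
    exact haj _ (by omega)
  have haa : thetaFac a q p N ≠ 0 := Finset.prod_ne_zero_iff.mpr fun j hj => by
    have hj := Finset.mem_range.mp hj
    exact haj _ (by omega)
  have haQ : thetaFac (q * Q / a) q p N ≠ 0 :=
    thetaFac_ne_zero_of_reverse (v := a) hp (by positivity) hq
      (by field_simp; linear_combination hQq) haa
  have heQ : thetaFac (b * c * d * Q / a * (Q / a)) q p N ≠ 0 :=
    thetaFac_ne_zero_of_reverse hp (by positivity) hq
      (by rw [pow_add]; field_simp; linear_combination (Q * q ^ N + 1) * hQq) he'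
  -- the `A_2` summation, with `x_1 / x_2 = a q ^ N` and `b_1, b_2` chosen so that `e / B = d`
  have hQinv : (1 : ℂ) / (Q / a) = a * q ^ N := by
    rw [one_div_div, div_eq_iff hQ0]
    linear_combination -a * hQq
  have hmain := sum_simplexTerm (n := 2) (q := q) (p := p) (x := ![1, Q / a])
    (b := ![b, c * (Q / a)]) (e := b * c * d * Q / a) (B := b * (c * (Q / a))) two_pos hp hq
    (by simp [Fin.forall_fin_two, hQ0, ha]) (by simp [Fin.forall_fin_two, hQ0, ha, hb, hc])
    (by simp) (Or.inl (by positivity)) N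
    (by
      simp only [Fin.forall_fin_two, Matrix.cons_val_zero, Matrix.cons_val_one, hQinv]
      simp [hθN])
    (by
      simp only [Fin.forall_fin_two, Matrix.cons_val_zero, Matrix.cons_val_one, hQinv,
        div_self hQa, div_one, mul_one]
      refine ⟨⟨hqN, ?_⟩, ?_, hqN⟩
      · rwa [show q * (a * q ^ N) = a * q ^ (N + 1) by ring]
      · rwa [← mul_div_assoc])
    (by
      simp only [Fin.forall_fin_two, Matrix.cons_val_zero, Matrix.cons_val_one, mul_one]
      exact ⟨heN, heQ⟩)
  have hsum : ∑ k ∈ Finset.piAntidiag (Finset.univ : Finset (Fin 2)) N,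
        simplexTerm ![1, Q / a] ![b, c * (Q / a)] (b * c * d * Q / a) (b * (c * (Q / a))) q p k
      = ∑ k ∈ Finset.range (N + 1), simplexTerm ![1, Q / a] ![b, c * (Q / a)] (b * c * d * Q / a)
        (b * (c * (Q / a))) q p ![k, N - k] := by
    rw [Finset.piAntidiag_univ_fin_eq_antidiagonalTuple, Finset.Nat.antidiagonalTuple_two,
      Finset.sum_map, Finset.Nat.sum_antidiagonal_eq_sum_range_succ_mk]
    rfl
  have hterm : ∀ k ∈ Finset.range (N + 1), _ := fun k hk =>
    simplexTerm_two hp hq ha hb hc hd hQ (Nat.lt_succ_iff.mp (Finset.mem_range.mp hk)) hθ hθN hqN haQ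
      hbN hcN hdN heN heQ haN
  have hprop := Finset.sum_congr rfl hterm
  rw [← Finset.sum_mul, ← Finset.sum_mul, ← Finset.sum_mul, ← hsum] at hprop
  simp only [Fin.prod_univ_two, Matrix.cons_val_zero, Matrix.cons_val_one, mul_one] at hmain
  have b1 : b * c * d * Q / a / b = c * d * Q / a := by field_simp
  have b2 : b * c * d * Q / a * (Q / a) / (c * (Q / a)) = b * d * Q / a := by field_simp
  have b3 : b * (c * (Q / a)) = b * c * Q / a := by ring
  rw [b1, b2, b3] at hmain
  rw [b3] at hprop
  have rev : ∀ {u : ℂ} (v : ℂ), u ≠ 0 → v * u = q * Q → thetaFac u q p N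
      = (-u) ^ N * (∏ i ∈ Finset.range N, q ^ (N - 1 - i)) * thetaFac v q p N := fun v hu h =>
    thetaFac_reverse hp hu hq (by rw [h]; linear_combination q * hQq)
  rw [rev (u := b * c * Q / a) (a * q / (b * c)) (by positivity) (by field_simp),
    rev (u := c * d * Q / a) (a * q / (c * d)) (by positivity) (by field_simp),
    rev (u := b * d * Q / a) (a * q / (b * d)) (by positivity) (by field_simp),
    rev (u := b * c * d * Q / a) (a * q / (b * c * d)) (by positivity) (by field_simp)] at hmain
  rw [rev (u := b * Q / a) (a * q / b) (by positivity) (by field_simp),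
    rev (u := c * Q / a) (a * q / c) (by positivity) (by field_simp),
    rev (u := d * Q / a) (a * q / d) (by positivity) (by field_simp),
    rev (u := q * Q / a) a (by positivity) (by field_simp)] at hprop
  have hshift : thetaFac a q p N * modTheta (a * q ^ N) p = modTheta a p * thetaFac (a * q) q p N := by
    rw [← thetaFac_succ, thetaFac_succ']
  have hM : ∏ i ∈ Finset.range N, q ^ (N - 1 - i) ≠ 0 :=
    Finset.prod_ne_zero_iff.mpr fun _ _ => pow_ne_zero _ hq
  have hpow : (-(q * Q / a)) ^ N * ((-(b * c * Q / a)) ^ N * (-(c * d * Q / a)) ^ N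
        * (-(b * d * Q / a)) ^ N)
      = q ^ N * ((-(b * Q / a)) ^ N * (-(c * Q / a)) ^ N * (-(d * Q / a)) ^ N)
        * (-(b * c * d * Q / a)) ^ N := by
    simp only [← mul_pow]
    congr 1
    field_simp
  have p1 : (-(b * c * d * Q / a)) ^ N ≠ 0 := pow_ne_zero _ (neg_ne_zero.mpr (by positivity))
  have p2 : (-(b * Q / a)) ^ N ≠ 0 := pow_ne_zero _ (neg_ne_zero.mpr (by positivity))
  have p3 : (-(c * Q / a)) ^ N ≠ 0 := pow_ne_zero _ (neg_ne_zero.mpr (by positivity))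
  have p4 : (-(d * Q / a)) ^ N ≠ 0 := pow_ne_zero _ (neg_ne_zero.mpr (by positivity))
  generalize ∑ k ∈ Finset.range (N + 1), jacksonTerm a b c d q p N k = J at *
  generalize (∑ k ∈ Finset.piAntidiag (Finset.univ : Finset (Fin 2)) N,
    simplexTerm ![1, Q / a] ![b, c * (Q / a)] (b * c * d * Q / a) (b * c * Q / a) q p k) = S at *
  generalize ∏ i ∈ Finset.range N, q ^ (N - 1 - i) = M at *
  generalize (-(q * Q / a)) ^ N = P0 at *
  generalize (-(b * Q / a)) ^ N = P1 at *
  generalize (-(c * Q / a)) ^ N = P2 at *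
  generalize (-(d * Q / a)) ^ N = P3 at *
  generalize (-(b * c * d * Q / a)) ^ N = P4 at *
  generalize (-(b * c * Q / a)) ^ N = P5 at *
  generalize (-(c * d * Q / a)) ^ N = P6 at *
  generalize (-(b * d * Q / a)) ^ N = P7 at *
  rw [eq_div_iff (by simp [hbN, hcN, hdN, hbcd])]
  have hK : q ^ N * modTheta a p * (P1 * P2 * P3) * M ^ 4 * P4 ≠ 0 := by
    simp [hq, hθ, hM, p1, p2, p3, p4]
  refine mul_left_cancel₀ hK ?_
  linear_combination (-(M * P4 * thetaFac (a * q / (b * c * d)) q p N)) * hprop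
    + (P0 * M * thetaFac a q p N * modTheta (a * q ^ N) p) * hmain
    + (P0 * (P5 * P6 * P7) * M ^ 4 * (thetaFac (a * q / (b * c)) q p N
      * thetaFac (a * q / (c * d)) q p N * thetaFac (a * q / (b * d)) q p N)) * hshift
    + (M ^ 4 * modTheta a p * thetaFac (a * q) q p N * (thetaFac (a * q / (b * c)) q p N
      * thetaFac (a * q / (c * d)) q p N * thetaFac (a * q / (b * d)) q p N)) * hpow

theorem ContinuousAt.thetaFac {X : Type*} [TopologicalSpace X] {f : X → ℂ} {x : X}
    (hf : ContinuousAt f x) (hp : ‖p‖ < 1) (hq : q ≠ 0) (h : f x ≠ 0) (k : ℕ) :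
    ContinuousAt (fun x => thetaFac (f x) q p k) x :=
  tendsto_finsetProd _ fun _ _ => (hf.mul continuousAt_const).modTheta hp
    (Or.inl (mul_ne_zero h (pow_ne_zero _ hq)))

/-- The one-variable elliptic Jackson (Frenkel–Turaev) summation. -/
theorem sum_jacksonTerm (hp : ‖p‖ < 1) (hq : q ≠ 0) (ha : a ≠ 0) (hb : b ≠ 0)
    (hc : c ≠ 0) (hd : d ≠ 0) (hθ : modTheta a p ≠ 0) (hqN : thetaFac q q p N ≠ 0)
    (hbN : thetaFac (a * q / b) q p N ≠ 0) (hcN : thetaFac (a * q / c) q p N ≠ 0)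
    (hdN : thetaFac (a * q / d) q p N ≠ 0)
    (heN : thetaFac (b * c * d * q ^ (-(N : ℤ)) / a) q p N ≠ 0)
    (hbcd : thetaFac (a * q / (b * c * d)) q p N ≠ 0)
    (haN : thetaFac (a * q ^ (N + 1)) q p N ≠ 0) :
    ∑ k ∈ Finset.range (N + 1), jacksonTerm a b c d q p N k
      = (thetaFac (a * q) q p N * thetaFac (a * q / (b * c)) q p N
          * thetaFac (a * q / (b * d)) q p N * thetaFac (a * q / (c * d)) q p N)
        / (thetaFac (a * q / b) q p N * thetaFac (a * q / c) q p N
          * thetaFac (a * q / d) q p N * thetaFac (a * q / (b * c * d)) q p N) := by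
  have hQ : q ^ (-(N : ℤ)) ≠ 0 := zpow_ne_zero _ hq
  -- all factors are continuous functions of the parameter `a`
  have hmul : ∀ {r : ℂ}, r ≠ 0 → ∀ k, ContinuousAt (fun z => thetaFac (z * q / r) q p k) a :=
    fun hr k => ContinuousAt.thetaFac (f := fun z => z * q / _) (by fun_prop) hp hq (div_ne_zero (mul_ne_zero ha hq) hr) k
  have hmulq : ∀ k, ContinuousAt (fun z => thetaFac (z * q) q p k) a :=
    fun k => ContinuousAt.thetaFac (f := fun z => z * q) (by fun_prop) hp hq (mul_ne_zero ha hq) k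
  have hmulN : ∀ k, ContinuousAt (fun z => thetaFac (z * q ^ (N + 1)) q p k) a :=
    fun k => ContinuousAt.thetaFac (f := fun z => z * q ^ (N + 1)) (by fun_prop) hp hq
      (mul_ne_zero ha (pow_ne_zero _ hq)) k
  have hdiv : ∀ k, ContinuousAt (fun z => thetaFac (b * c * d * q ^ (-(N : ℤ)) / z) q p k) a :=
    fun k => ContinuousAt.thetaFac (continuousAt_const.div continuousAt_id ha) hp hq
      (div_ne_zero (mul_ne_zero (mul_ne_zero (mul_ne_zero hb hc) hd) hQ) ha) k
  have hsq : ∀ k, ContinuousAt (fun z => thetaFac (z ^ 2 * q ^ (1 + N) / (b * c * d)) q p k) a :=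
    fun k => ContinuousAt.thetaFac (by fun_prop) hp hq (by positivity) k
  have hid : ∀ k, ContinuousAt (fun z => thetaFac z q p k) a :=
    fun k => ContinuousAt.thetaFac continuousAt_id hp hq ha k
  have hT : ContinuousAt (fun z => modTheta z p) a := continuousAt_modTheta hp (Or.inl ha)
  have hTk : ∀ k : ℕ, ContinuousAt (fun z => modTheta (z * q ^ k) p) a := fun k =>
    ContinuousAt.modTheta (by fun_prop) hp (Or.inl (mul_ne_zero ha (pow_ne_zero _ hq)))
  have hbc := mul_ne_zero hb hc
  have hbd := mul_ne_zero hb hd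
  have hcd := mul_ne_zero hc hd
  have hbcd0 := mul_ne_zero hbc hd
  -- the values of `a` excluded in `sum_jacksonTerm_of_generic` form a countable set
  set S : Set ℂ := (⋃ j : ℕ, Set.range fun m : ℤ => p ^ m / q ^ j)
    ∪ ⋃ j : ℕ, ⋃ m : ℤ, {z | z ^ 2 = p ^ m * (b * c * d) / (q ^ (1 + N) * q ^ j)} with hS
  have hScount : S.Countable := by
    refine (Set.countable_iUnion fun j => Set.countable_range _).union
      (Set.countable_iUnion fun j => Set.countable_iUnion fun m => ?_)
    obtain ⟨s, hs⟩ := IsAlgClosed.exists_pow_nat_eq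
      (p ^ m * (b * c * d) / (q ^ (1 + N) * q ^ j)) two_pos
    refine (Set.toFinite {s, -s}).countable.mono fun z hz => ?_
    rw [Set.mem_ofPred_eq, ← hs] at hz
    simpa using sq_eq_sq_iff_eq_or_eq_neg.mp hz
  refine eq_of_eventually_eq_off_countable
    (f := fun a => ∑ k ∈ Finset.range (N + 1), jacksonTerm a b c d q p N k)
    (g := fun a => (thetaFac (a * q) q p N * thetaFac (a * q / (b * c)) q p N
          * thetaFac (a * q / (b * d)) q p N * thetaFac (a * q / (c * d)) q p N)
        / (thetaFac (a * q / b) q p N * thetaFac (a * q / c) q p N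
          * thetaFac (a * q / d) q p N * thetaFac (a * q / (b * c * d)) q p N)) hScount ?_ ?_ ?_
  · refine tendsto_finsetSum _ fun k hk => ?_
    have hk : k ≤ N := Nat.lt_succ_iff.mp (Finset.mem_range.mp hk)
    have n1 := thetaFac_ne_zero_of_le hqN hk
    have n2 := thetaFac_ne_zero_of_le hbN hk
    have n3 := thetaFac_ne_zero_of_le hcN hk
    have n4 := thetaFac_ne_zero_of_le hdN hk
    have n5 := thetaFac_ne_zero_of_le heN hk
    have n6 := thetaFac_ne_zero_of_le haN hk
    refine ContinuousAt.mul (ContinuousAt.mul ((hTk _).div hT hθ) (ContinuousAt.div ?_ ?_ ?_))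
      continuousAt_const
    · exact (((((hid k).mul continuousAt_const).mul continuousAt_const).mul continuousAt_const).mul
        (hsq k)).mul continuousAt_const
    · exact ((((continuousAt_const.mul (hmul hb k)).mul (hmul hc k)).mul (hmul hd k)).mul
        (hdiv k)).mul (hmulN k)
    · exact mul_ne_zero (mul_ne_zero (mul_ne_zero (mul_ne_zero (mul_ne_zero n1 n2) n3) n4) n5) n6
  · refine ContinuousAt.div ((((hmulq N).mul (hmul hbc N)).mul (hmul hbd N)).mul (hmul hcd N))
      ((((hmul hb N).mul (hmul hc N)).mul (hmul hd N)).mul (hmul hbcd0 N)) ?_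
    simp [hbN, hcN, hdN, hbcd]
  · filter_upwards [isOpen_ne.mem_nhds ha, (hmul hb N).eventually_ne hbN,
      (hmul hc N).eventually_ne hcN, (hmul hd N).eventually_ne hdN, (hdiv N).eventually_ne heN,
      (hmul hbcd0 N).eventually_ne hbcd] with z hz z1 z2 z3 z4 z5 hzS
    rw [hS, Set.mem_union, not_or] at hzS
    refine sum_jacksonTerm_of_generic hp hq hz hb hc hd hqN z1 z2 z3 z4 z5 (fun j _ h => ?_)
      (Finset.prod_ne_zero_iff.mpr fun j _ h => ?_)
    · obtain ⟨m, hm⟩ := exists_zpow_of_modTheta_eq_zero hp (mul_ne_zero hz (pow_ne_zero j hq)) h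
      refine hzS.1 (Set.mem_iUnion.mpr ⟨j, m, ?_⟩)
      simp only
      rw [← hm, mul_div_cancel_right₀ _ (pow_ne_zero j hq)]
    · have hz2 : z ≠ 0 := hz
      obtain ⟨m, hm⟩ := exists_zpow_of_modTheta_eq_zero hp
        (by have := pow_ne_zero j hq; positivity) h
      refine hzS.2 (Set.mem_iUnion.mpr ⟨j, Set.mem_iUnion.mpr ⟨m, ?_⟩⟩)
      rw [Set.mem_ofPred_eq, ← hm]
      have := pow_ne_zero j hq
      have := pow_ne_zero (1 + N) hq
      field_simp

end Jackson

/-! ### The summation over the full simplex -/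

theorem sum_indexSimplex (n N : ℕ) (f : (Fin n → ℕ) → ℂ) :
    ∑ k ∈ indexSimplex n N, f k
      = ∑ K ∈ Finset.range (N + 1), ∑ k ∈ Finset.piAntidiag Finset.univ K, f k := by
  rw [← Finset.sum_fiberwise_of_maps_to (s := indexSimplex n N) (t := Finset.range (N + 1))
    (g := fun k => ∑ r, k r) fun k hk =>
      Finset.mem_range.mpr (Nat.lt_succ_of_le ((mem_indexSimplex k).mp hk))]
  refine Finset.sum_congr rfl fun K hK => Finset.sum_congr ?_ fun _ _ => rfl
  ext k
  have hK : K ≤ N := Nat.lt_succ_iff.mp (Finset.mem_range.mp hK)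
  simp only [Finset.mem_filter, mem_indexSimplex, Finset.mem_piAntidiag, Finset.mem_univ,
    implies_true, and_true]
  exact ⟨fun h => h.2, fun h => ⟨h.trans_le hK, h⟩⟩

theorem mainTheorem4 (n : ℕ) (hn : 0 < n) (N : ℕ)
    (q p a c d e : ℂ) (b x : Fin n → ℂ) (B : ℂ) (hB : B = ∏ s, b s)
    (hp : ‖p‖ < 1) (hq : q ≠ 0) (ha : a ≠ 0) (hc : c ≠ 0) (hd : d ≠ 0)
    (he : e ≠ 0 ∨ p = 0) (hb : ∀ r, b r ≠ 0) (hx : ∀ r, x r ≠ 0)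
    (hvand : ∀ r s, r < s → modTheta (x r / x s) p ≠ 0)
    (hqx : ∀ r s, thetaFac (q * (x r / x s)) q p N ≠ 0)
    (hθa : modTheta a p ≠ 0)
    (haB : thetaFac (a * q / B) q p N ≠ 0)
    (hac : thetaFac (a * q / c) q p N ≠ 0)
    (had : thetaFac (a * q / d) q p N ≠ 0)
    (hBcd : thetaFac (B * c * d * q ^ (-(N : ℤ)) / a) q p N ≠ 0)
    (haBcd : thetaFac (a * q / (B * c * d)) q p N ≠ 0)
    (haN : thetaFac (a * q ^ (N + 1)) q p N ≠ 0)
    (hex : ∀ r, thetaFac (e * x r) q p N ≠ 0)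
    (hexb : ∀ r, thetaFac (e * x r / b r) q p N ≠ 0) :
    ∑ k ∈ indexSimplex n N,
        (ellipticVandermonde x q p k
          * (∏ r, ∏ s, thetaFac (b s * (x r / x s)) q p (k r)
              / thetaFac (q * (x r / x s)) q p (k r))
          * (modTheta (a * q ^ (2 * ∑ r, k r)) p / modTheta a p)
          * ((thetaFac a q p (∑ r, k r) * thetaFac c q p (∑ r, k r)
                * thetaFac d q p (∑ r, k r)
                * thetaFac (a ^ 2 * q ^ (1 + N) / (B * c * d)) q p (∑ r, k r)
                * thetaFac (q ^ (-(N : ℤ))) q p (∑ r, k r))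
              / (thetaFac (a * q / B) q p (∑ r, k r) * thetaFac (a * q / c) q p (∑ r, k r)
                * thetaFac (a * q / d) q p (∑ r, k r)
                * thetaFac (B * c * d * q ^ (-(N : ℤ)) / a) q p (∑ r, k r)
                * thetaFac (a * q ^ (N + 1)) q p (∑ r, k r)))
          * (∏ r, (thetaFac (e * x r / B) q p (k r) * thetaFac (e * x r) q p (∑ t, k t))
              / (thetaFac (e * x r) q p (k r) * thetaFac (e * x r / b r) q p (∑ t, k t)))
          * q ^ (∑ r : Fin n, ((r : ℕ) + 1) * k r))
      = (thetaFac (a * q) q p N * thetaFac (a * q / (B * c)) q p N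
            * thetaFac (a * q / (B * d)) q p N * thetaFac (a * q / (c * d)) q p N)
          / (thetaFac (a * q / B) q p N * thetaFac (a * q / c) q p N
            * thetaFac (a * q / d) q p N * thetaFac (a * q / (B * c * d)) q p N) := by
  have hB0 : B ≠ 0 := hB ▸ Finset.prod_ne_zero_iff.mpr fun s _ => hb s
  have hqN : thetaFac q q p N ≠ 0 := by
    have := hqx ⟨0, hn⟩ ⟨0, hn⟩
    rwa [div_self (hx _), mul_one] at this
  rw [← sum_jacksonTerm hp hq ha hB0 hc hd hθa hqN haB hac had hBcd haBcd haN, sum_indexSimplex]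
  refine Finset.sum_congr rfl fun K hK => ?_
  have hK : K ≤ N := Nat.lt_succ_iff.mp (Finset.mem_range.mp hK)
  have hinner := sum_simplexTerm hn hp hq hx hb hB he K hvand
    (fun r s => thetaFac_ne_zero_of_le (hqx r s) hK) (fun r => thetaFac_ne_zero_of_le (hex r) hK)
  have hqK := thetaFac_ne_zero_of_le hqN hK
  have hexK : ∏ r, thetaFac (e * x r) q p K ≠ 0 :=
    Finset.prod_ne_zero_iff.mpr fun r _ => thetaFac_ne_zero_of_le (hex r) hK
  have hexbK : ∏ r, thetaFac (e * x r / b r) q p K ≠ 0 :=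
    Finset.prod_ne_zero_iff.mpr fun r _ => thetaFac_ne_zero_of_le (hexb r) hK
  -- the part of the summand that depends on more than `|k|`
  have hsum : ∑ k ∈ Finset.piAntidiag Finset.univ K, simplexTerm x b e B q p k
        * ((∏ r, thetaFac (e * x r) q p K) / ∏ r, thetaFac (e * x r / b r) q p K)
      = thetaFac B q p K / thetaFac q q p K := by
    rw [← Finset.sum_mul]
    field_simp
    linear_combination hinner
  rw [jacksonTerm, show ∀ X Y : ℂ, modTheta (a * q ^ (2 * K)) p / modTheta a p
      * ((thetaFac a q p K * thetaFac B q p K * thetaFac c q p K * thetaFac d q p K * X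
          * Y) / (thetaFac q q p K * thetaFac (a * q / B) q p K * thetaFac (a * q / c) q p K
          * thetaFac (a * q / d) q p K * thetaFac (B * c * d * q ^ (-(N : ℤ)) / a) q p K
          * thetaFac (a * q ^ (N + 1)) q p K)) * q ^ K
      = modTheta (a * q ^ (2 * K)) p / modTheta a p
      * ((thetaFac a q p K * thetaFac c q p K * thetaFac d q p K * X * Y)
        / (thetaFac (a * q / B) q p K * thetaFac (a * q / c) q p K
          * thetaFac (a * q / d) q p K * thetaFac (B * c * d * q ^ (-(N : ℤ)) / a) q p K
          * thetaFac (a * q ^ (N + 1)) q p K)) * q ^ K * (thetaFac B q p K / thetaFac q q p K) by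
      intro X Y; ring, ← hsum, Finset.mul_sum]
  refine Finset.sum_congr rfl fun k hk => ?_
  have hkK : ∑ r, k r = K := (Finset.mem_piAntidiag.mp hk).1
  rw [hkK]
  have h1 : ∏ r, (thetaFac (e * x r / B) q p (k r) * thetaFac (e * x r) q p K)
        / (thetaFac (e * x r) q p (k r) * thetaFac (e * x r / b r) q p K)
      = (∏ r, thetaFac (e * x r / B) q p (k r) / thetaFac (e * x r) q p (k r))
        * ((∏ r, thetaFac (e * x r) q p K) / ∏ r, thetaFac (e * x r / b r) q p K) := by
    rw [← Finset.prod_div_distrib, ← Finset.prod_mul_distrib]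
    exact Finset.prod_congr rfl fun r _ => mul_div_mul_comm _ _ _ _
  have h2 : q ^ (∑ r : Fin n, ((r : ℕ) + 1) * k r) = q ^ (∑ r : Fin n, (r : ℕ) * k r) * q ^ K := by
    rw [← pow_add, ← hkK, ← Finset.sum_add_distrib]
    congr 1
    exact Finset.sum_congr rfl fun r _ => by ring
  rw [h1, h2, simplexTerm]
  ring
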